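/- **Setting.** Let $a<b$ be real and $n\in\mathbb N$. Put $\mathcal J=\begin{pmatrix}0&I\\-I&0\end{pmatrix}\in\mathbb R^{2n\times 2n}$ and $E=\begin{pmatrix}0\\ I\end{pmatrix}\in\mathbb R^{2n\times n}$; a matrix $S\in\mathbb R^{2n\times2n}$ is symplectic if $S^T\mathcal JS=\mathcal J$. A continuous Lagrangian path on $[a,b]$ is a continuous $Y=\begin{pmatrix}X\\U\end{pmatrix}:[a,b]\to\mathbb R^{2n\times n}$ ($X,U$ being $n\times n$ blocks) with $Y^T(t)\mathcal JY(t)=0$ and $\operatorname{rank}Y(t)=n$ for all $t\in[a,b]$. For constant matrices $Y=\begin{pmatrix}X\\U\end{pmatrix}$ and $\hat Y=\begin{pmatrix}\hat X\\ \hat U\end{pmatrix}$ with these two properties, put $W(Y,\hat Y)=Y^T\mathcal J\hat Y$, $$\mathcal M=(I-X^\dagger X)\,W(Y,\hat Y),\qquad V=I-\mathcal M^\dagger\mathcal M,\qquad \mathcal P=V\,[W(Y,\hat Y)]^TX^\dagger\hat X\,V,$$ where $\dagger$ is the Moore–Penrose pseudoinverse, and define the comparative index $\mu(Y,\hat Y)=\operatorname{rank}\mathcal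 M+\operatorname{ind}\mathcal P$ and the dual comparative index $\mu^*(Y,\hat Y)=\operatorname{rank}\mathcal M+\operatorname{ind}(-\mathcal P)$, where $\operatorname{ind}$ is the number of negative eigenvalues counted with multiplicity. For a continuous Lagrangian path $Y$ on $[a,b]$, consider a partition $D=\{a=t_0<t_1<\dots<t_p=b\}$ and a system $R=\{R_k\}_{k=0}^{p-1}$ of symplectic matrix functions on $[a,b]$, with $R_k$ continuous on $[t_k,t_{k+1}]$, such that for each $k$ both $\operatorname{rank}W(R_k(t)E,Y(t))$ and $\operatorname{rank}\big((I\ \,0)R_k(t)E\big)$ are constant on $[t_k,t_{k+1}]$. Call such a pair $(D,R)$ admissible for $Y$, and put $$\mathcal N(Y,D,R)=\sum_{k=0}^{p-1}\Big(\mu\big(Y(t_{k+1}),R_k(t_{k+1})E\big)-\mu\big(Y(t_k),R_k(t_k)E\big)\Big),$$ $$\mathcal N^*(Y,D,R)=\sum_{k=0}^{p-1}\Big(\mu^*\big(Y(t_k),R_k(t_k)E\big)-\mu^*\big(Y(t_{k+1}),R_k(t_{k+1})E\big)\Big).$$ The oscillation number $\mathcal N(Y)$ and the dual oscillation number $\mathcal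 N^*(Y)$ of $Y$ on $[a,b]$ are the values of $\mathcal N(Y,D,R)$ and $\mathcal N^*(Y,D,R)$ for any admissible pair $(D,R)$. **Theorem.** Let $Y_1=\begin{pmatrix}X_1\\U_1\end{pmatrix}$ and $Y_2=\begin{pmatrix}X_2\\U_2\end{pmatrix}$ be continuous Lagrangian paths on $[a,b]$ with values in $\mathbb R^{2n_1\times n_1}$ and $\mathbb R^{2n_2\times n_2}$, respectively. Let $$\Pi=\begin{pmatrix}I_{n_1}&0&0&0\\0&0&I_{n_2}&0\\0&I_{n_1}&0&0\\0&0&0&I_{n_2}\end{pmatrix},\qquad Y(t)=\Pi\,\operatorname{diag}\{Y_1(t),Y_2(t)\}=\begin{pmatrix}\operatorname{diag}\{X_1(t),X_2(t)\}\\ \operatorname{diag}\{U_1(t),U_2(t)\}\end{pmatrix},\quad t\in[a,b].$$ Then $Y$ is a continuous Lagrangian path on $[a,b]$ with values in $\mathbb R^{2n\times n}$, $n=n_1+n_2$; the oscillation numbers and dual oscillation numbers of $Y_1$, $Y_2$ and $Y$ on $[a,b]$ are well defined (admissible pairs exist, and the values do not depend on the choice of the pair); and $$\mathcal N(Y)=\mathcal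 N(Y_1)+\mathcal N(Y_2),\qquad \mathcal N^*(Y)=\mathcal N^*(Y_1)+\mathcal N^*(Y_2).$$ -/

import Mathlib

open Matrix Set

/- Throughout, `ι` is a finite index type; its cardinality is the dimension `n`.  Real `2n × n`
matrices have rows indexed by `ι ⊕ ι`: the first copy of `ι` indexes the upper block `X` and the
second copy the lower block `U`. -/

namespace Lagr

section MoorePenrose

variable {m n : Type*} [Fintype m] [Fintype n]

/-- The four Penrose equations: `B` is the Moore-Penrose pseudoinverse of the real matrix `A`. -/
structure IsMoorePenrose (A : Matrix m n ℝ) (B : Matrix n m ℝ) : Prop where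
  mul_mul_left : A * B * A = A
  mul_mul_right : B * A * B = B
  symm_left : (A * B)ᵀ = A * B
  symm_right : (B * A)ᵀ = B * A

theorem IsMoorePenrose.unique {A : Matrix m n ℝ} {B C : Matrix n m ℝ}
    (hB : IsMoorePenrose A B) (hC : IsMoorePenrose A C) : B = C := by
  have hBt : Aᵀ * Bᵀ * Aᵀ = Aᵀ := by
    have h := congrArg transpose hB.mul_mul_left
    simpa only [transpose_mul, Matrix.mul_assoc] using h
  have h1 : A * B = A * C := by
    calc A * B = (A * C * A) * B := by rw [hC.mul_mul_left]
      _ = (A * C) * (A * B) := by simp only [Matrix.mul_assoc]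
      _ = (A * C)ᵀ * (A * B)ᵀ := by rw [hC.symm_left, hB.symm_left]
      _ = Cᵀ * (Aᵀ * Bᵀ * Aᵀ) := by
          simp only [transpose_mul, Matrix.mul_assoc]
      _ = (A * C)ᵀ := by rw [hBt, transpose_mul]
      _ = A * C := hC.symm_left
  have h2 : B * A = C * A := by
    calc B * A = B * (A * C * A) := by rw [hC.mul_mul_left]
      _ = (B * A) * (C * A) := by simp only [Matrix.mul_assoc]
      _ = (B * A)ᵀ * (C * A)ᵀ := by rw [hB.symm_right, hC.symm_right]
      _ = (Aᵀ * Bᵀ * Aᵀ) * Cᵀ := by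
          simp only [transpose_mul, Matrix.mul_assoc]
      _ = (C * A)ᵀ := by rw [hBt, transpose_mul]
      _ = C * A := hC.symm_right
  calc B = B * A * B := hB.mul_mul_right.symm
    _ = C * (A * B) := by rw [h2, Matrix.mul_assoc]
    _ = C * A * C := by rw [h1, Matrix.mul_assoc]
    _ = C := hC.mul_mul_right

theorem exists_isMoorePenrose (A : Matrix m n ℝ) : ∃ B, IsMoorePenrose A B := by
  classical
  have hS : (Aᵀ * A).IsHermitian := by
    simpa [conjTranspose_eq_transpose_of_trivial] using isHermitian_conjTranspose_mul_self A
  obtain ⟨U, d, hU1, hAA⟩ : ∃ (U : Matrix n n ℝ) (d : n → ℝ), Uᵀ * U = 1 ∧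
      Aᵀ * A = U * diagonal d * Uᵀ := by
    refine ⟨(hS.eigenvectorUnitary : Matrix n n ℝ), hS.eigenvalues, ?_, ?_⟩
    · have h := Unitary.coe_star_mul_self hS.eigenvectorUnitary
      simpa [star_eq_conjTranspose, conjTranspose_eq_transpose_of_trivial] using h
    · have h := hS.spectral_theorem
      rw [Unitary.conjStarAlgAut_apply] at h
      simpa [star_eq_conjTranspose, conjTranspose_eq_transpose_of_trivial,
        Function.comp_def] using h
  set G : Matrix n n ℝ := U * diagonal (fun i => (d i)⁻¹) * Uᵀ with hG
  have key : ∀ e f : n → ℝ, (U * diagonal e * Uᵀ) * (U * diagonal f * Uᵀ)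
      = U * diagonal (fun i => e i * f i) * Uᵀ := by
    intro e f
    calc (U * diagonal e * Uᵀ) * (U * diagonal f * Uᵀ)
        = U * diagonal e * (Uᵀ * U) * (diagonal f * Uᵀ) := by simp only [Matrix.mul_assoc]
      _ = U * (diagonal e * diagonal f) * Uᵀ := by
          rw [hU1]; simp only [Matrix.mul_assoc, Matrix.mul_one]
      _ = _ := by rw [diagonal_mul_diagonal]
  have symm : ∀ e : n → ℝ, (U * diagonal e * Uᵀ)ᵀ = U * diagonal e * Uᵀ := by
    intro e; simp [transpose_mul, Matrix.mul_assoc]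
  have hGB : G * (Aᵀ * A) = U * diagonal (fun i => (d i)⁻¹ * d i) * Uᵀ := by rw [hAA, hG, key]
  have hGBs : (G * (Aᵀ * A))ᵀ = G * (Aᵀ * A) := by rw [hGB, symm]
  have hGBG : G * (Aᵀ * A) * G = G := by
    rw [hGB, hG, key]
    congr 3; funext i
    by_cases h : d i = 0 <;> simp [h]
  have hBGB : (Aᵀ * A) * (G * (Aᵀ * A)) = Aᵀ * A := by
    rw [hGB, hAA, key]
    congr 3; funext i
    by_cases h : d i = 0 <;> simp [h]
  have hA : A * (G * (Aᵀ * A)) = A := by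
    have h0 : (A * (G * (Aᵀ * A)) - A)ᴴ * (A * (G * (Aᵀ * A)) - A) = 0 := by
      rw [conjTranspose_eq_transpose_of_trivial, transpose_sub, transpose_mul, hGBs]
      have : (G * (Aᵀ * A) * Aᵀ - Aᵀ) * (A * (G * (Aᵀ * A)) - A)
          = G * (Aᵀ * A) * ((Aᵀ * A) * (G * (Aᵀ * A))) - G * (Aᵀ * A) * (Aᵀ * A)
            - ((Aᵀ * A) * (G * (Aᵀ * A)) - Aᵀ * A) := by
        simp only [Matrix.mul_sub, Matrix.sub_mul, Matrix.mul_assoc]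
        abel
      rw [this, hBGB]; simp
    exact sub_eq_zero.mp (conjTranspose_mul_self_eq_zero.mp h0)
  refine ⟨G * Aᵀ, ?_, ?_, ?_, ?_⟩
  · simpa only [Matrix.mul_assoc] using hA
  · have h := congrArg (fun M => M * Aᵀ) hGBG
    simpa only [Matrix.mul_assoc] using h
  · rw [transpose_mul, transpose_mul, transpose_transpose, hG, symm, Matrix.mul_assoc]
  · rw [Matrix.mul_assoc, hGBs]

/-- The Moore-Penrose pseudoinverse of a real matrix. -/
noncomputable def pinv (A : Matrix m n ℝ) : Matrix n m ℝ :=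
  Classical.choose (exists_isMoorePenrose A)

theorem pinv_spec (A : Matrix m n ℝ) : IsMoorePenrose A (pinv A) :=
  Classical.choose_spec (exists_isMoorePenrose A)

end MoorePenrose

variable {ι : Type*} [Fintype ι] [DecidableEq ι]

/-- The canonical skew-symmetric matrix `(0 I; -I 0)` of dimension `2n × 2n`. -/
def skewJ (ι : Type*) [DecidableEq ι] : Matrix (ι ⊕ ι) (ι ⊕ ι) ℝ :=
  fromBlocks 0 1 (-1) 0

/-- The vertical Lagrangian plane `E = (0 I)ᵀ`. -/
def vert (ι : Type*) [DecidableEq ι] : Matrix (ι ⊕ ι) ι ℝ := fromRows 0 1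

/-- The matrix `S` is symplectic: `Sᵀ J S = J`. -/
def IsSymplectic (S : Matrix (ι ⊕ ι) (ι ⊕ ι) ℝ) : Prop := Sᵀ * skewJ ι * S = skewJ ι

/-- The Wronskian `W(Y, Y') = Yᵀ J Y'`. -/
def wronskian (Y Y' : Matrix (ι ⊕ ι) ι ℝ) : Matrix ι ι ℝ := Yᵀ * skewJ ι * Y'

/-- `Y` is a continuous Lagrangian path on `[a, b]`. -/
structure IsLagrangianPath (a b : ℝ) (Y : ℝ → Matrix (ι ⊕ ι) ι ℝ) : Prop where
  continuousOn : ContinuousOn Y (Icc a b)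
  isotropic : ∀ t ∈ Icc a b, (Y t)ᵀ * skewJ ι * Y t = 0
  rank_eq : ∀ t ∈ Icc a b, (Y t).rank = Fintype.card ι

/-- The number of negative eigenvalues, with multiplicity, of a (symmetric) real matrix. -/
noncomputable def ind (P : Matrix ι ι ℝ) : ℕ :=
  (P.charpoly.roots.filter (fun x => x < 0)).card

/-- The matrix `M = (I - X† X) W(Y, Y')`. -/
noncomputable def matM (Y Y' : Matrix (ι ⊕ ι) ι ℝ) : Matrix ι ι ℝ :=
  (1 - pinv Y.toRows₁ * Y.toRows₁) * wronskian Y Y'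

/-- The matrix `V = I - M† M`. -/
noncomputable def matV (Y Y' : Matrix (ι ⊕ ι) ι ℝ) : Matrix ι ι ℝ :=
  1 - pinv (matM Y Y') * matM Y Y'

/-- The matrix `P = V W(Y, Y')ᵀ X† X' V`. -/
noncomputable def matP (Y Y' : Matrix (ι ⊕ ι) ι ℝ) : Matrix ι ι ℝ :=
  matV Y Y' * (wronskian Y Y')ᵀ * pinv Y.toRows₁ * Y'.toRows₁ * matV Y Y'

/-- The comparative index `μ(Y, Y')`. -/
noncomputable def compIndex (Y Y' : Matrix (ι ⊕ ι) ι ℝ) : ℕ :=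
  (matM Y Y').rank + ind (matP Y Y')

/-- The dual comparative index `μ*(Y, Y')`. -/
noncomputable def dualCompIndex (Y Y' : Matrix (ι ⊕ ι) ι ℝ) : ℕ :=
  (matM Y Y').rank + ind (-matP Y Y')

/-- The partition `a = t₀ < t₁ < ⋯ < t_p = b` and the matrix functions `R₀, …, R_{p-1}` are
admissible for the path `Y` on `[a, b]`: every `R_k` is symplectic on `[a, b]` and continuous on
`[t_k, t_{k+1}]`, and on `[t_k, t_{k+1}]` both the rank of the Wronskian `W(R_k E, Y)` and the
rank of the upper block `(I 0) R_k E` are constant. -/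
structure IsAdmissible (a b : ℝ) (Y : ℝ → Matrix (ι ⊕ ι) ι ℝ) {p : ℕ} (t : Fin (p + 1) → ℝ)
    (R : Fin p → ℝ → Matrix (ι ⊕ ι) (ι ⊕ ι) ℝ) : Prop where
  strictMono : StrictMono t
  left_eq : t 0 = a
  right_eq : t (Fin.last p) = b
  symplectic : ∀ k, ∀ s ∈ Icc a b, IsSymplectic (R k s)
  continuousOn : ∀ k, ContinuousOn (R k) (Icc (t k.castSucc) (t k.succ))
  rank_wronskian : ∀ k, ∃ r : ℕ, ∀ s ∈ Icc (t k.castSucc) (t k.succ),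
    (wronskian (R k s * vert ι) (Y s)).rank = r
  rank_upper : ∀ k, ∃ r : ℕ, ∀ s ∈ Icc (t k.castSucc) (t k.succ),
    ((R k s * vert ι).toRows₁).rank = r

/-- `N(Y, D, R) = ∑ₖ (μ(Y(t_{k+1}), R_k(t_{k+1}) E) - μ(Y(t_k), R_k(t_k) E))`. -/
noncomputable def oscSum (Y : ℝ → Matrix (ι ⊕ ι) ι ℝ) {p : ℕ} (t : Fin (p + 1) → ℝ)
    (R : Fin p → ℝ → Matrix (ι ⊕ ι) (ι ⊕ ι) ℝ) : ℤ :=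
  ∑ k : Fin p, ((compIndex (Y (t k.succ)) (R k (t k.succ) * vert ι) : ℤ)
    - (compIndex (Y (t k.castSucc)) (R k (t k.castSucc) * vert ι) : ℤ))

/-- `N*(Y, D, R) = ∑ₖ (μ*(Y(t_k), R_k(t_k) E) - μ*(Y(t_{k+1}), R_k(t_{k+1}) E))`. -/
noncomputable def dualOscSum (Y : ℝ → Matrix (ι ⊕ ι) ι ℝ) {p : ℕ} (t : Fin (p + 1) → ℝ)
    (R : Fin p → ℝ → Matrix (ι ⊕ ι) (ι ⊕ ι) ℝ) : ℤ :=
  ∑ k : Fin p, ((dualCompIndex (Y (t k.castSucc)) (R k (t k.castSucc) * vert ι) : ℤ)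
    - (dualCompIndex (Y (t k.succ)) (R k (t k.succ) * vert ι) : ℤ))

/-- `ν` is the value of `N(Y, D, R)` for some admissible partition `D` and system `R`. -/
def IsOscValue (a b : ℝ) (Y : ℝ → Matrix (ι ⊕ ι) ι ℝ) (ν : ℤ) : Prop :=
  ∃ (p : ℕ) (t : Fin (p + 1) → ℝ) (R : Fin p → ℝ → Matrix (ι ⊕ ι) (ι ⊕ ι) ℝ),
    IsAdmissible a b Y t R ∧ oscSum Y t R = ν

/-- `ν` is the value of `N*(Y, D, R)` for some admissible partition `D` and system `R`. -/
def IsDualOscValue (a b : ℝ) (Y : ℝ → Matrix (ι ⊕ ι) ι ℝ) (ν : ℤ) : Prop :=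
  ∃ (p : ℕ) (t : Fin (p + 1) → ℝ) (R : Fin p → ℝ → Matrix (ι ⊕ ι) (ι ⊕ ι) ℝ),
    IsAdmissible a b Y t R ∧ dualOscSum Y t R = ν

/-- The oscillation number of `Y` on `[a, b]`: the value of `N(Y, D, R)` for an arbitrary choice
of an admissible pair `(D, R)`. -/
noncomputable def oscNumber (a b : ℝ) (Y : ℝ → Matrix (ι ⊕ ι) ι ℝ) : ℤ :=
  Classical.epsilon (IsOscValue a b Y)

/-- The dual oscillation number of `Y` on `[a, b]`: the value of `N*(Y, D, R)` for an arbitrary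
choice of an admissible pair `(D, R)`. -/
noncomputable def dualOscNumber (a b : ℝ) (Y : ℝ → Matrix (ι ⊕ ι) ι ℝ) : ℤ :=
  Classical.epsilon (IsDualOscValue a b Y)

/-- The permutation matrix `Π`, with block rows of sizes `n₁, n₂, n₁, n₂` and block columns of
sizes `n₁, n₁, n₂, n₂`. -/
def permPi (ι₁ ι₂ : Type*) [DecidableEq ι₁] [DecidableEq ι₂] :
    Matrix ((ι₁ ⊕ ι₂) ⊕ (ι₁ ⊕ ι₂)) ((ι₁ ⊕ ι₁) ⊕ (ι₂ ⊕ ι₂)) ℝ :=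
  fromBlocks (fromBlocks 1 0 0 0) (fromBlocks 0 0 1 0)
    (fromBlocks 0 1 0 0) (fromBlocks 0 0 0 1)

end Lagr

open Lagr

set_option linter.unusedSectionVars false

namespace Lagr

/-! ### Inertia of symmetric matrices -/

section Inertia

variable {ι κ : Type*} [Fintype ι] [DecidableEq ι] [Fintype κ] [DecidableEq κ]

/-! For all but finitely many real `λ` the matrix `λX - U` is invertible, and the Lagrangian plane
of `Y` is then represented by the symmetric matrix `A = X(λX - U)⁻¹`. If `B` represents `Y'` for the
same `λ`, then `μ(Y, Y') = ind(B - A) + ind(-B) - ind(-A)`, and `μ*` satisfies the same formula with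
all signs inside `ind` reversed (`compIndex_add_ind`, `dualCompIndex_add_ind`). Both come from
reducing one block matrix by congruence in two ways.

For `Y' = R_k E`, admissibility says exactly that `B` and `B - A` have constant rank. A continuous
symmetric matrix of constant rank has locally constant index (`eventually_ind_eq`), so `μ(Y, R_k E)
+ ind(-A)` is locally constant. The term `ind(-A)` depends on `Y` and `λ` alone: on each piece `μ`
is a primitive of a datum that does not see `R_k` (`isPrimitive_compIndex`). Primitives glue across
partition points, and two primitives of the same datum differ by a constant on an interval
(`IsPrimitive.sub_eq_sub`). Hence every admissible pair gives the same number.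

Additivity follows: `ind(-A)` is additive over direct sums, so primitives for `Y₁` and `Y₂` add up
to one for `Y`. The partitions and systems used for the three paths need not be related. -/

theorem exists_orthogonal_diagonalization {P : Matrix ι ι ℝ} (hP : P.IsSymm) :
    ∃ (U : Matrix ι ι ℝ) (d : ι → ℝ), Uᵀ * U = 1 ∧ P = U * diagonal d * Uᵀ := by
  have hS : P.IsHermitian := by
    rw [IsHermitian, conjTranspose_eq_transpose_of_trivial, hP]
  refine ⟨(hS.eigenvectorUnitary : Matrix ι ι ℝ), hS.eigenvalues, ?_, ?_⟩
  · have h := Unitary.coe_star_mul_self hS.eigenvectorUnitary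
    simpa [star_eq_conjTranspose, conjTranspose_eq_transpose_of_trivial] using h
  · have h := hS.spectral_theorem
    rw [Unitary.conjStarAlgAut_apply] at h
    simpa [star_eq_conjTranspose, conjTranspose_eq_transpose_of_trivial,
      Function.comp_def] using h

theorem ind_conj_diagonal {U : Matrix ι ι ℝ} (hU : Uᵀ * U = 1) (d : ι → ℝ) :
    ind (U * diagonal d * Uᵀ) = Fintype.card {i // d i < 0} := by
  have h : (U * diagonal d * Uᵀ).charpoly = (diagonal d).charpoly := by
    rw [charpoly_mul_comm, ← Matrix.mul_assoc, hU, Matrix.one_mul]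
  have h2 : (diagonal d).charpoly.roots = (Finset.univ.val : Multiset ι).map d := by
    rw [charpoly_diagonal, ← Polynomial.roots_multiset_prod_X_sub_C (Finset.univ.val.map d),
      Multiset.map_map]
    rfl
  rw [ind, h, h2, Multiset.filter_map, Multiset.card_map, Fintype.card_subtype]
  rfl

theorem ind_reindex (e : ι ≃ κ) (P : Matrix ι ι ℝ) : ind (reindex e e P) = ind P := by
  rw [ind, charpoly_reindex, ind]

theorem ind_fromBlocks (P : Matrix ι ι ℝ) (Q : Matrix κ κ ℝ) :
    ind (fromBlocks P 0 0 Q) = ind P + ind Q := by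
  rw [ind, charpoly_fromBlocks_zero₁₂, Polynomial.roots_mul, Multiset.filter_add,
    Multiset.card_add, ind, ind]
  exact mul_ne_zero P.charpoly_monic.ne_zero Q.charpoly_monic.ne_zero

/-- Negative and positive eigenvalues together are the nonzero ones. -/
theorem ind_add_ind_neg {P : Matrix ι ι ℝ} (hP : P.IsSymm) : ind P + ind (-P) = P.rank := by
  obtain ⟨U, d, hU, rfl⟩ := exists_orthogonal_diagonalization hP
  have hneg : -(U * diagonal d * Uᵀ) = U * diagonal (fun i => -d i) * Uᵀ := by
    rw [show diagonal (fun i => -d i) = -diagonal d from (diagonal_neg d).symm, Matrix.mul_neg,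
      Matrix.neg_mul]
  have hdet : IsUnit U.det := by
    have h := congrArg det hU
    rw [det_mul, det_one] at h
    exact IsUnit.of_mul_eq_one _ (by rw [mul_comm]; exact h)
  rw [hneg, ind_conj_diagonal hU, ind_conj_diagonal hU,
    rank_mul_eq_left_of_isUnit_det _ _ (by simpa using hdet),
    rank_mul_eq_right_of_isUnit_det _ _ hdet, rank_diagonal, ← Fintype.card_sum]
  classical
  simp only [neg_lt_zero]
  rw [Fintype.card_sum, ← Fintype.card_subtype_or_disjoint]
  · exact Fintype.card_congr (Equiv.subtypeEquivRight fun i => ne_iff_lt_or_gt.symm)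
  · rw [disjoint_iff_inf_le]
    rintro i ⟨h1, h2⟩
    exact absurd h1 (not_lt.mpr h2.le)

/-- The columns of `C` are the eigenvectors with negative eigenvalue. With the converse bound
`card_le_ind_of_negDef`, this makes `ind` the largest dimension of a negative definite restriction.
-/
theorem exists_negDef_restriction {P : Matrix ι ι ℝ} (hP : P.IsSymm) :
    ∃ C : Matrix ι (Fin (ind P)) ℝ, ∀ z, z ≠ 0 → z ⬝ᵥ ((Cᵀ * P * C) *ᵥ z) < 0 := by
  obtain ⟨U, d, hU, h⟩ := exists_orthogonal_diagonalization hP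
  have hk : Fintype.card {i // d i < 0} = ind P := by rw [h, ind_conj_diagonal hU]
  let e : Fin (ind P) ≃ {i // d i < 0} := (Fintype.equivFinOfCardEq hk).symm
  let D : Matrix ι (Fin (ind P)) ℝ := (1 : Matrix ι ι ℝ).submatrix id (fun j => (e j).1)
  refine ⟨U * D, fun z hz => ?_⟩
  have h2 : (U * D)ᵀ * P * (U * D) = diagonal (fun j => d (e j).1) := by
    calc (U * D)ᵀ * P * (U * D) = Dᵀ * (Uᵀ * U) * diagonal d * (Uᵀ * U) * D := by
          have h' : ∀ C : Matrix ι (Fin (ind P)) ℝ,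
              Cᵀ * P * C = Cᵀ * (U * diagonal d * Uᵀ) * C := fun C => by rw [← h]
          rw [h']
          simp only [transpose_mul, Matrix.mul_assoc]
      _ = Dᵀ * diagonal d * D := by rw [hU]; simp
      _ = _ := by
          ext i j
          rw [Matrix.mul_apply]
          simp only [D, mul_diagonal, transpose_apply, submatrix_apply, id, one_apply, diagonal_apply]
          simp [Subtype.coe_inj, eq_comm]
          split_ifs with h3
          · rw [h3]
          · rfl
  rw [h2]
  simp only [mulVec_diagonal, dotProduct]
  have : ∃ j, z j ≠ 0 := Function.ne_iff.mp hz
  obtain ⟨j, hj⟩ := this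
  refine Finset.sum_neg' (fun i _ => ?_) ⟨j, Finset.mem_univ _, ?_⟩
  · have := (e i).2
    nlinarith [mul_self_nonneg (z i)]
  · have := (e j).2
    nlinarith [mul_self_pos.mpr hj]

/-- The components along the negative eigenvectors determine `z`: were they all zero, the form at
`z` would be nonnegative. -/
theorem card_le_ind_of_negDef {P : Matrix ι ι ℝ} (hP : P.IsSymm) (C : Matrix ι κ ℝ)
    (hC : ∀ z, z ≠ 0 → z ⬝ᵥ ((Cᵀ * P * C) *ᵥ z) < 0) : Fintype.card κ ≤ ind P := by
  obtain ⟨U, d, hU, h⟩ := exists_orthogonal_diagonalization hP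
  have hk : Fintype.card {i // d i < 0} = ind P := by rw [h, ind_conj_diagonal hU]
  let f : (κ → ℝ) →ₗ[ℝ] ({i // d i < 0} → ℝ) :=
    (LinearMap.funLeft ℝ ℝ Subtype.val).comp (Uᵀ * C).mulVecLin
  have hf : Function.Injective f := by
    rw [injective_iff_map_eq_zero]
    intro z hz
    by_contra hz0
    refine absurd (hC z hz0) (not_lt.mpr ?_)
    have h2 : z ⬝ᵥ ((Cᵀ * P * C) *ᵥ z)
        = ((Uᵀ * C) *ᵥ z) ⬝ᵥ (diagonal d *ᵥ ((Uᵀ * C) *ᵥ z)) := by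
      rw [h, mulVec_mulVec, ← vecMul_transpose (Uᵀ * C), ← dotProduct_mulVec, mulVec_mulVec]
      simp only [transpose_mul, transpose_transpose, Matrix.mul_assoc]
    rw [h2]
    simp only [mulVec_diagonal, dotProduct]
    refine Finset.sum_nonneg fun i _ => ?_
    by_cases hi : d i < 0
    · have : ((Uᵀ * C) *ᵥ z) i = 0 := congrFun hz ⟨i, hi⟩
      rw [this]; simp
    · nlinarith [mul_self_nonneg (((Uᵀ * C) *ᵥ z) i)]
  have := LinearMap.finrank_le_finrank_of_injective hf
  rw [Module.finrank_fintype_fun_eq_card, Module.finrank_fintype_fun_eq_card] at this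
  exact this.trans_eq hk

theorem isSymm_congruence {P : Matrix ι ι ℝ} (hP : P.IsSymm) (C : Matrix ι κ ℝ) :
    (Cᵀ * P * C).IsSymm := by
  rw [IsSymm, transpose_mul, transpose_mul, transpose_transpose, hP, Matrix.mul_assoc]

theorem ind_congruence_le {P : Matrix ι ι ℝ} (hP : P.IsSymm) (C : Matrix ι κ ℝ) :
    ind (Cᵀ * P * C) ≤ ind P := by
  obtain ⟨D, hD⟩ := exists_negDef_restriction (isSymm_congruence hP C)
  have := card_le_ind_of_negDef hP (C * D) (by
    simpa only [transpose_mul, Matrix.mul_assoc] using hD)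
  simpa using this

/-- Sylvester's law of inertia. -/
theorem ind_congruence {P : Matrix ι ι ℝ} (hP : P.IsSymm) {C : Matrix ι κ ℝ} {D : Matrix κ ι ℝ}
    (h : C * D = 1) : ind (Cᵀ * P * C) = ind P := by
  refine le_antisymm (ind_congruence_le hP C) ?_
  have h1 := ind_congruence_le (isSymm_congruence hP C) D
  have h2 : Dᵀ * (Cᵀ * P * C) * D = (C * D)ᵀ * P * (C * D) := by
    simp only [transpose_mul, Matrix.mul_assoc]
  rw [h2, h] at h1
  simpa using h1

theorem ind_neg_congruence {P : Matrix ι ι ℝ} (hP : P.IsSymm) {C : Matrix ι κ ℝ}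
    {D : Matrix κ ι ℝ} (h : C * D = 1) : ind (-(Cᵀ * P * C)) = ind (-P) := by
  rw [← ind_congruence hP.neg h]
  simp

/-- Changing the sign of one block of coordinates negates the form, so its negative and positive
indices agree, and their sum is the rank `2 rank M`. -/
theorem ind_antidiagonal (M : Matrix κ ι ℝ) : ind (fromBlocks 0 M Mᵀ 0) = M.rank := by
  have hS : (fromBlocks 0 M Mᵀ 0 : Matrix (κ ⊕ ι) (κ ⊕ ι) ℝ).IsSymm := by
    rw [IsSymm, fromBlocks_transpose]; simp
  have hneg : ind (-(fromBlocks 0 M Mᵀ 0 : Matrix (κ ⊕ ι) (κ ⊕ ι) ℝ))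
      = ind (fromBlocks 0 M Mᵀ 0) := by
    have hC : (fromBlocks 1 0 0 (-1) : Matrix (κ ⊕ ι) (κ ⊕ ι) ℝ) * fromBlocks 1 0 0 (-1) = 1 := by
      simp [fromBlocks_multiply]
    rw [← ind_congruence hS hC]
    simp [fromBlocks_multiply, fromBlocks_transpose, fromBlocks_neg]
  have h1 := ind_add_ind_neg hS
  have hMM : (M * Mᵀ).IsSymm := by rw [IsSymm, transpose_mul, transpose_transpose]
  have hMM' : (Mᵀ * M).IsSymm := by rw [IsSymm, transpose_mul, transpose_transpose]
  have hD : (fromBlocks (M * Mᵀ) 0 0 (Mᵀ * M)).IsSymm := by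
    rw [IsSymm, fromBlocks_transpose, hMM, hMM']; simp
  have h2 : (fromBlocks 0 M Mᵀ 0).rank = M.rank + M.rank := by
    rw [← rank_transpose_mul_self, hS]
    have : fromBlocks 0 M Mᵀ 0 * fromBlocks 0 M Mᵀ 0 = fromBlocks (M * Mᵀ) 0 0 (Mᵀ * M) := by
      simp [fromBlocks_multiply]
    rw [this, ← ind_add_ind_neg hD, fromBlocks_neg, neg_zero, neg_zero, ind_fromBlocks, ind_fromBlocks,
      ← rank_self_mul_transpose M]
    nth_rewrite 2 [rank_self_mul_transpose]
    rw [← rank_transpose_mul_self M, ← ind_add_ind_neg hMM, ← ind_add_ind_neg hMM']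
    ring
  omega

end Inertia

/-! ### Semicontinuity of the index -/

section Semicontinuity

variable {ι : Type*} [Fintype ι] [DecidableEq ι] {T : Type*} [TopologicalSpace T]

open Filter Topology

/-- Negative definiteness on a fixed subspace is an open condition, by compactness of the unit
sphere. -/
theorem eventually_ind_le {P : T → Matrix ι ι ℝ} {I : Set T} {τ : T}
    (hP : ContinuousWithinAt P I τ) (hs : ∀ᶠ s in 𝓝[I] τ, (P s).IsSymm) (hτ : τ ∈ I) :
    ∀ᶠ s in 𝓝[I] τ, ind (P τ) ≤ ind (P s) := by
  obtain ⟨C, hC⟩ := exists_negDef_restriction (hs.self_of_nhdsWithin hτ)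
  have hev : ∀ᶠ Q in 𝓝 (P τ), ∀ z ∈ Metric.sphere (0 : Fin (ind (P τ)) → ℝ) 1,
      z ⬝ᵥ ((Cᵀ * Q * C) *ᵥ z) < 0 := by
    refine (isCompact_sphere _ _).eventually_forall_of_forall_eventually fun z hz => ?_
    have hcont : Continuous fun p : Matrix ι ι ℝ × (Fin (ind (P τ)) → ℝ) =>
        p.2 ⬝ᵥ ((Cᵀ * p.1 * C) *ᵥ p.2) := by fun_prop
    refine hcont.continuousAt.eventually (gt_mem_nhds (hC z ?_))
    rintro rfl
    simp at hz
  filter_upwards [hP.eventually hev, hs] with s h1 h2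
  have := card_le_ind_of_negDef h2 C (fun z hz => ?_)
  · simpa using this
  have hn : 0 < ‖z‖ := norm_pos_iff.mpr hz
  -- The form is homogeneous of degree two, so negativity on the sphere suffices.
  have h3 := h1 (‖z‖⁻¹ • z) (by simp [norm_smul, hn.ne'])
  rw [mulVec_smul, dotProduct_smul, smul_dotProduct, smul_eq_mul, smul_eq_mul, ← mul_assoc] at h3
  have h4 : 0 < ‖z‖⁻¹ * ‖z‖⁻¹ := by positivity
  by_contra hcon
  exact absurd h3 (not_lt.mpr (mul_nonneg h4.le (not_lt.mp hcon)))

/-- `ind P` and `ind (-P)` can only jump up near `τ`, while their sum is the constant rank. -/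
theorem eventually_ind_eq {P : T → Matrix ι ι ℝ} {I : Set T} {τ : T}
    (hP : ContinuousWithinAt P I τ) (hs : ∀ᶠ s in 𝓝[I] τ, (P s).IsSymm) (hτ : τ ∈ I)
    (hr : ∀ᶠ s in 𝓝[I] τ, (P s).rank = (P τ).rank) :
    ∀ᶠ s in 𝓝[I] τ, ind (P s) = ind (P τ) ∧ ind (-P s) = ind (-P τ) := by
  filter_upwards [hr, eventually_ind_le hP hs hτ, hs,
    eventually_ind_le hP.neg (hs.mono fun s h => h.neg) hτ] with s h1 h2 h3 h4
  have h5 := ind_add_ind_neg h3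
  have h6 := ind_add_ind_neg (hs.self_of_nhdsWithin hτ)
  simp only [Pi.neg_apply] at h4
  omega

end Semicontinuity

/-! ### Inertia of block matrices -/

section BlockInertia

variable {ι κ : Type*} [Fintype ι] [DecidableEq ι] [Fintype κ] [DecidableEq κ]

theorem ind_fromBlocks_swap (A : Matrix ι ι ℝ) (B : Matrix ι κ ℝ) (C : Matrix κ ι ℝ)
    (D : Matrix κ κ ℝ) : ind (fromBlocks A B C D) = ind (fromBlocks D C B A) := by
  rw [← ind_reindex (Equiv.sumComm κ ι) (fromBlocks D C B A)]
  congr 1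
  ext i j
  rcases i with i | i <;> rcases j with j | j <;> rfl

/-- If the off-diagonal blocks of a symmetric matrix are annihilated by an idempotent which fixes
the upper left block, that block splits off. -/
theorem ind_fromBlocks_of_idempotent {P e : Matrix κ κ ℝ} {N : Matrix κ ι ℝ} {F : Matrix ι ι ℝ}
    (hP : P.IsSymm) (hF : F.IsSymm) (he : e * e = e) (hPe : P * e = P) (hN : eᵀ * N = 0) :
    ind (fromBlocks P N Nᵀ F) = ind P + ind (fromBlocks 0 N Nᵀ F) := by
  have hNe : Nᵀ * e = 0 := by
    have := congrArg transpose hN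
    simpa using this
  have hPe' : eᵀ * P = P := by
    have := congrArg transpose hPe
    rwa [transpose_mul, hP] at this
  -- `C` is a surjection from a space with `κ` doubled: the range of `e` carries `P`, that of `1 -
  -- e` carries `N`. `ind_congruence` needs only a right inverse, so `C` need not be square.
  let C : Matrix (κ ⊕ ι) (κ ⊕ (κ ⊕ ι)) ℝ :=
    fromBlocks e (fromCols (1 - e) 0) 0 (fromCols 0 1)
  let D : Matrix (κ ⊕ (κ ⊕ ι)) (κ ⊕ ι) ℝ :=
    fromBlocks e 0 (fromRows (1 - e) 0) (fromRows 0 1)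
  have hCD : C * D = 1 := by
    simp [C, D, fromBlocks_multiply, fromCols_mul_fromRows, Matrix.mul_sub, Matrix.sub_mul, he]
  have hS : (fromBlocks P N Nᵀ F).IsSymm := by
    rw [IsSymm, fromBlocks_transpose, hP, hF, transpose_transpose]
  have key : Cᵀ * fromBlocks P N Nᵀ F * C = fromBlocks P 0 0 (fromBlocks 0 N Nᵀ F) := by
    simp only [C, fromBlocks_transpose, fromBlocks_multiply, transpose_fromCols,
      fromRows_mul, mul_fromCols]
    simp [Matrix.mul_sub, Matrix.sub_mul, hPe, hPe', hN, hNe]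
    ext i j
    rcases i with i | i <;> rcases j with j | j <;> simp
  rw [← ind_congruence hS hCD, key, ind_fromBlocks]

/-- The border clears from `F` everything outside the kernel of `N`, onto which `1 - pinv N * N`
projects. The compressed block then splits off and leaves an antidiagonal matrix of index `rank N`.
-/
theorem ind_bordered (N : Matrix κ ι ℝ) {F : Matrix ι ι ℝ} (hF : F.IsSymm) :
    ind (fromBlocks F Nᵀ N 0)
      = N.rank + ind ((1 - pinv N * N) * F * (1 - pinv N * N)) := by
  obtain ⟨h1, -, -, h4⟩ := pinv_spec N
  set p := pinv N * N with hp
  have hNp : N * p = N := by rw [hp, ← Matrix.mul_assoc, h1]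
  have hpN : p * Nᵀ = Nᵀ := by
    have := congrArg transpose hNp
    rwa [transpose_mul, h4] at this
  have hpp : p * p = p := by rw [hp, Matrix.mul_assoc, ← hp, hNp]
  have hVt : (1 - p)ᵀ = 1 - p := by rw [transpose_sub, h4, transpose_one]
  have hVV : (1 - p) * (1 - p) = 1 - p := by
    rw [Matrix.mul_sub, Matrix.sub_mul, Matrix.sub_mul, hpp]; simp
  have hNN : Nᵀ * (pinv N)ᵀ = p := by rw [← transpose_mul, h4]
  have hVFV : ((1 - p) * F * (1 - p)).IsSymm := by
    have := isSymm_congruence hF (1 - p)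
    rwa [hVt] at this
  -- With `p = N†N`, what has to be removed from `F` is `pF + Fp - pFp`. The factor `1/2` shares
  -- `pFp` equally between `NᵀL` and its transpose.
  let L : Matrix κ ι ℝ := -((pinv N)ᵀ * (F - (1 / 2 : ℝ) • (F * p)))
  have hNL : Nᵀ * L = -(p * (F - (1 / 2 : ℝ) • (F * p))) := by
    simp only [L, Matrix.mul_neg]
    rw [← Matrix.mul_assoc, hNN]
  have hLN : Lᵀ * N = -((F - (1 / 2 : ℝ) • (p * F)) * p) := by
    have := congrArg transpose hNL
    rw [transpose_mul, transpose_transpose] at this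
    rw [this]
    simp only [transpose_neg, transpose_mul, transpose_sub, transpose_smul, h4, hF.eq]
  have hC : (fromBlocks 1 0 L 1 : Matrix (ι ⊕ κ) (ι ⊕ κ) ℝ) * fromBlocks 1 0 (-L) 1 = 1 := by
    simp [fromBlocks_multiply]
  have hS : (fromBlocks F Nᵀ N 0).IsSymm := by
    rw [IsSymm, fromBlocks_transpose, hF, transpose_transpose, transpose_zero]
  rw [← ind_congruence hS hC]
  have key : (fromBlocks 1 0 L 1 : Matrix (ι ⊕ κ) (ι ⊕ κ) ℝ)ᵀ * fromBlocks F Nᵀ N 0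
      * fromBlocks 1 0 L 1 = fromBlocks ((1 - p) * F * (1 - p)) Nᵀ Nᵀᵀ 0 := by
    simp only [fromBlocks_transpose, fromBlocks_multiply, transpose_one, transpose_zero,
      Matrix.one_mul, Matrix.mul_one, Matrix.zero_mul, Matrix.mul_zero, add_zero, zero_add,
      transpose_transpose]
    rw [hNL, hLN]
    congr 1
    simp only [Matrix.mul_sub, Matrix.sub_mul, Matrix.one_mul, Matrix.mul_one, Matrix.smul_mul,
      Matrix.mul_smul, Matrix.mul_assoc]
    module
  rw [key, ind_fromBlocks_of_idempotent hVFV (isSymm_zero) hVV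
    (by rw [Matrix.mul_assoc, hVV]) (by rw [hVt, Matrix.sub_mul, hpN]; simp),
    ind_antidiagonal, rank_transpose, add_comm]

/-- Both sides are the index of `(-A B; B -B)`. Adding the columns (and rows) of the second block to
the first gives `diag(B - A, -B)`. Shearing by `HB` instead makes the off-diagonal block `N = B -
AHB`, which the projection `AH` annihilates, so `-A` splits off. -/
theorem ind_add_ind_neg_eq_of_generalizedInverse {A B H : Matrix ι ι ℝ} (hA : A.IsSymm)
    (hB : B.IsSymm) (hH : H.IsSymm) (h1 : A * H * A = A) (h2 : H * A * H = H) :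
    ind (fromBlocks (B * H * B - B) (B - B * H * A) (B - A * H * B) 0) + ind (-A)
      = ind (B - A) + ind (-B) := by
  have h1' : A * (H * A) = A := by rw [← Matrix.mul_assoc, h1]
  have h2' : H * (A * H) = H := by rw [← Matrix.mul_assoc, h2]
  have h2'' : ∀ Z : Matrix ι ι ℝ, H * (A * (H * Z)) = H * Z := fun Z => by
    rw [← Matrix.mul_assoc A, ← Matrix.mul_assoc H, h2']
  have hS : (fromBlocks (-A) B B (-B)).IsSymm := by
    rw [IsSymm, fromBlocks_transpose, hB, hB.neg, hA.neg]
  have e1 : ind (fromBlocks (-A) B B (-B)) = ind (B - A) + ind (-B) := by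
    have hC : (fromBlocks 1 0 1 1 : Matrix (ι ⊕ ι) (ι ⊕ ι) ℝ) * fromBlocks 1 0 (-1) 1 = 1 := by
      simp [fromBlocks_multiply]
    rw [← ind_congruence hS hC, ← ind_fromBlocks]
    simp [fromBlocks_multiply, fromBlocks_transpose, sub_eq_neg_add]
  have hNt : (B - A * H * B)ᵀ = B - B * H * A := by
    simp only [transpose_sub, transpose_mul, hA.eq, hB.eq, hH.eq, Matrix.mul_assoc]
  have e2 : ind (fromBlocks (-A) B B (-B))
      = ind (fromBlocks (-A) (B - A * H * B) (B - A * H * B)ᵀ (B * H * B - B)) := by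
    have hC : (fromBlocks 1 (H * B) 0 1 : Matrix (ι ⊕ ι) (ι ⊕ ι) ℝ)
        * fromBlocks 1 (-(H * B)) 0 1 = 1 := by
      simp [fromBlocks_multiply]
    rw [← ind_congruence hS hC]
    congr 1
    simp only [fromBlocks_transpose, fromBlocks_multiply, transpose_one, transpose_zero,
      Matrix.one_mul, Matrix.mul_one, Matrix.zero_mul, Matrix.mul_zero, add_zero,
      transpose_mul, hB.eq, hH.eq, hNt]
    congr 1
    · rw [Matrix.neg_mul, Matrix.mul_assoc]; abel
    · rw [Matrix.mul_neg]; abel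
    · simp only [Matrix.mul_neg, Matrix.add_mul, Matrix.neg_mul, Matrix.mul_assoc, h2'']
      abel
  have hF : (B * H * B - B).IsSymm := by
    rw [IsSymm, transpose_sub, transpose_mul, transpose_mul, hB, hH, Matrix.mul_assoc]
  rw [← e1, e2, ind_fromBlocks_of_idempotent (e := H * A) hA.neg hF
    (by rw [← Matrix.mul_assoc, h2]) (by rw [Matrix.neg_mul, h1'])
    (by rw [transpose_mul, hA, hH, Matrix.mul_sub]
        simp only [← Matrix.mul_assoc, h1]
        rw [sub_self]), hNt, ind_fromBlocks_swap (0 : Matrix ι ι ℝ), add_comm]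

end BlockInertia

/-! ### The comparative index in coordinates -/

section ComparativeIndex

variable {ι : Type*} [Fintype ι] [DecidableEq ι]

theorem wronskian_eq (Y Y' : Matrix (ι ⊕ ι) ι ℝ) :
    wronskian Y Y' = Y.toRows₁ᵀ * Y'.toRows₂ - Y.toRows₂ᵀ * Y'.toRows₁ := by
  conv_lhs => rw [wronskian, ← fromRows_toRows Y, ← fromRows_toRows Y']
  rw [transpose_fromRows, skewJ, fromCols_mul_fromBlocks, fromCols_mul_fromRows]
  simp [sub_eq_neg_add]

/-- The matrix `λX - U`, invertible exactly when the plane of `Y` is transversal to the plane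
spanned by `(I λI)ᵀ`. -/
def denom (l : ℝ) (Y : Matrix (ι ⊕ ι) ι ℝ) : Matrix ι ι ℝ := l • Y.toRows₁ - Y.toRows₂

/-- The matrix `X (λX - U)⁻¹` that represents the plane of `Y`. -/
noncomputable def coord (l : ℝ) (Y : Matrix (ι ⊕ ι) ι ℝ) : Matrix ι ι ℝ :=
  Y.toRows₁ * (denom l Y)⁻¹

variable {Y Y' : Matrix (ι ⊕ ι) ι ℝ} {l : ℝ}

theorem coord_mul_denom (h : IsUnit (denom l Y).det) : coord l Y * denom l Y = Y.toRows₁ := by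
  rw [coord, Matrix.mul_assoc, nonsing_inv_mul _ h, Matrix.mul_one]

theorem transpose_denom_mul (hY : wronskian Y Y = 0) :
    (denom l Y)ᵀ * Y.toRows₁ = Y.toRows₁ᵀ * denom l Y := by
  rw [wronskian_eq, sub_eq_zero] at hY
  simp [denom, Matrix.sub_mul, Matrix.mul_sub, hY]

theorem isSymm_transpose_denom_mul (hY : wronskian Y Y = 0) :
    ((denom l Y)ᵀ * Y.toRows₁).IsSymm := by
  rw [IsSymm, transpose_mul, transpose_transpose, transpose_denom_mul hY]

theorem denom_congruence_coord (h : IsUnit (denom l Y).det) :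
    (denom l Y)ᵀ * coord l Y * denom l Y = (denom l Y)ᵀ * Y.toRows₁ := by
  rw [Matrix.mul_assoc, coord_mul_denom h]

theorem isSymm_coord (hY : wronskian Y Y = 0) (h : IsUnit (denom l Y).det) :
    (coord l Y).IsSymm := by
  have h1 := isSymm_congruence (isSymm_transpose_denom_mul (l := l) hY) (denom l Y)⁻¹
  rwa [← denom_congruence_coord h, ← Matrix.mul_assoc, ← Matrix.mul_assoc, ← transpose_mul,
    mul_nonsing_inv _ h, transpose_one, Matrix.one_mul, Matrix.mul_assoc, mul_nonsing_inv _ h,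
    Matrix.mul_one] at h1

/-- This turns the rank of the Wronskian into the rank of a difference of coordinates. -/
theorem wronskian_eq_denom_mul (hY : wronskian Y Y = 0) (h : IsUnit (denom l Y).det)
    (h' : IsUnit (denom l Y').det) :
    wronskian Y Y' = (denom l Y)ᵀ * (coord l Y' - coord l Y) * denom l Y' := by
  have h1 : (denom l Y)ᵀ * coord l Y = Y.toRows₁ᵀ := by
    rw [← coord_mul_denom h, transpose_mul, (isSymm_coord hY h).eq]
  rw [Matrix.mul_sub, Matrix.sub_mul, Matrix.mul_assoc, coord_mul_denom h', h1, wronskian_eq,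
    denom, denom]
  simp [Matrix.sub_mul, Matrix.mul_sub]

/-- With `K = λX - U` invertible, `A` and `B` the coordinates of `Y` and `Y'`, the matrices that
define the comparative index are congruent to expressions in `A`, `B` and a generalized inverse of
`A`. -/
theorem exists_generalizedInverse (hY : wronskian Y Y = 0)
    (hY' : wronskian Y' Y' = 0) (h : IsUnit (denom l Y).det) (h' : IsUnit (denom l Y').det) :
    ∃ H : Matrix ι ι ℝ, H.IsSymm ∧ coord l Y * H * coord l Y = coord l Y ∧
      H * coord l Y * H = H ∧
      matM Y Y' = (denom l Y)ᵀ * (coord l Y' - coord l Y * H * coord l Y') * denom l Y' ∧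
      matP Y Y' = matV Y Y' * ((denom l Y')ᵀ * (coord l Y' * H * coord l Y' - coord l Y')
        * denom l Y') * matV Y Y' := by
  have hW := wronskian_eq_denom_mul hY h h'
  have hA := isSymm_coord hY h
  have hB := isSymm_coord hY' h'
  have hX := coord_mul_denom h
  have hX' := coord_mul_denom h'
  obtain ⟨p1, p2, p3, p4⟩ := pinv_spec Y.toRows₁
  have hMV : matM Y Y' * matV Y Y' = 0 := by
    rw [matV, Matrix.mul_sub, ← Matrix.mul_assoc, (pinv_spec (matM Y Y')).mul_mul_left]; simp
  have hKi := mul_nonsing_inv _ h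
  have hM : matM Y Y' = (1 - pinv Y.toRows₁ * Y.toRows₁) * wronskian Y Y' := rfl
  have hP : matP Y Y' = matV Y Y' * (wronskian Y Y')ᵀ * pinv Y.toRows₁ * Y'.toRows₁
    * matV Y Y' := rfl
  set A := coord l Y
  set B := coord l Y'
  set K := denom l Y
  set K' := denom l Y'
  set x := pinv Y.toRows₁
  set V := matV Y Y'
  rw [← hX] at p1 p2 p3 p4
  -- `G = K X†` is a generalized inverse of `A = X K⁻¹`, in general not symmetric; `G * A * Gᵀ` is
  -- one that is symmetric.
  set G := K * x with hG
  have hAG : A * G * A = A := by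
    calc A * G * A = (A * K * x * (A * K)) * K⁻¹ := by
          simp only [hG, Matrix.mul_assoc, hKi, Matrix.mul_one]
      _ = A := by rw [p1, Matrix.mul_assoc, hKi, Matrix.mul_one]
  have hGA : G * A * G = G := by
    calc G * A * G = K * (x * (A * K) * x) := by simp only [hG, Matrix.mul_assoc]
      _ = G := by rw [p2]
  have hAG' : A * Gᵀ * A = A := by
    have := congrArg transpose hAG
    simpa only [transpose_mul, hA.eq, Matrix.mul_assoc] using this
  have t1 : ∀ Z : Matrix ι ι ℝ, A * (G * (A * Z)) = A * Z := fun Z => by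
    rw [← Matrix.mul_assoc, ← Matrix.mul_assoc, hAG]
  have t2 : ∀ Z : Matrix ι ι ℝ, A * (Gᵀ * (A * Z)) = A * Z := fun Z => by
    rw [← Matrix.mul_assoc, ← Matrix.mul_assoc, hAG']
  have t2' : A * (Gᵀ * A) = A := by rw [← Matrix.mul_assoc, hAG']
  have t3 : ∀ Z : Matrix ι ι ℝ, G * (A * (G * Z)) = G * Z := fun Z => by
    rw [← Matrix.mul_assoc, ← Matrix.mul_assoc, hGA]
  have hMN : matM Y Y' = Kᵀ * (B - A * (G * A * Gᵀ) * B) * K' := by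
    -- This is the symmetry of the projection `X†X`.
    have hproj : x * (A * K) * Kᵀ = Kᵀ * A * Gᵀ := by
      rw [← p4, hG, transpose_mul, transpose_mul, transpose_mul, hA.eq]
      simp only [Matrix.mul_assoc]
    rw [hM, hW, ← hX]
    have : (1 - x * (A * K)) * (Kᵀ * (B - A) * K')
        = Kᵀ * (B - A) * K' - x * (A * K) * Kᵀ * (B - A) * K' := by
      simp only [Matrix.sub_mul, Matrix.one_mul, Matrix.mul_assoc]
    rw [this, hproj]
    simp only [Matrix.mul_sub, Matrix.sub_mul, Matrix.mul_assoc, t1, t2]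
    abel
  refine ⟨G * A * Gᵀ, ?_, ?_, ?_, hMN, ?_⟩
  · simpa only [transpose_transpose] using isSymm_congruence hA Gᵀ
  · simp only [Matrix.mul_assoc, t1, t2']
  · simp only [Matrix.mul_assoc, t2, t3]
  · have hNV : (B - A * (G * A * Gᵀ) * B) * (K' * V) = 0 := by
      have h1 : Kᵀ⁻¹ * Kᵀ = 1 := nonsing_inv_mul _ (by simpa using h)
      have h2 : Kᵀ⁻¹ * (matM Y Y' * V) = (B - A * (G * A * Gᵀ) * B) * (K' * V) := by
        rw [hMN]
        simp only [← Matrix.mul_assoc, h1, Matrix.one_mul]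
      rw [← h2, hMV, Matrix.mul_zero]
    -- The middle factor of `P` differs from `BHB - B` by a left multiple of `B - AHB`, and that
    -- vanishes on `K'V` because `MV = 0`.
    have h3 : (B - A) * G * B = (B * (G * A * Gᵀ) * B - B)
        + (1 + (B - A) * G) * (B - A * (G * A * Gᵀ) * B) := by
      simp only [Matrix.mul_sub, Matrix.sub_mul, Matrix.add_mul, Matrix.one_mul, Matrix.mul_assoc,
        t1]
      abel
    have h4 : matP Y Y' = V * K'ᵀ * ((B - A) * G * B) * (K' * V) := by
      rw [hP, hW, ← hX']
      simp only [transpose_mul, transpose_sub, hA.eq, hB.eq, transpose_transpose, hG,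
        Matrix.mul_assoc]
    rw [h4, h3, Matrix.mul_add, Matrix.add_mul]
    have h5 : V * K'ᵀ * ((1 + (B - A) * G) * (B - A * (G * A * Gᵀ) * B)) * (K' * V) = 0 := by
      rw [Matrix.mul_assoc (V * K'ᵀ), Matrix.mul_assoc (1 + (B - A) * G), hNV]
      simp
    rw [h5, add_zero]
    simp only [Matrix.mul_assoc]

theorem ind_bordered_congruence {F N K K' : Matrix ι ι ℝ} (hF : F.IsSymm) (hK : IsUnit K.det)
    (hK' : IsUnit K'.det) :
    ind (fromBlocks (K'ᵀ * F * K') (Kᵀ * N * K')ᵀ (Kᵀ * N * K') 0)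
      = ind (fromBlocks F Nᵀ N 0) := by
  have hC : (fromBlocks K' 0 0 K : Matrix (ι ⊕ ι) (ι ⊕ ι) ℝ) * fromBlocks K'⁻¹ 0 0 K⁻¹ = 1 := by
    simp [fromBlocks_multiply, mul_nonsing_inv _ hK, mul_nonsing_inv _ hK']
  have hS : (fromBlocks F Nᵀ N 0).IsSymm := by
    rw [IsSymm, fromBlocks_transpose, hF, transpose_transpose, transpose_zero]
  rw [← ind_congruence hS hC]
  simp [fromBlocks_multiply, fromBlocks_transpose, Matrix.mul_assoc]

/-- `rank M + ind P` is the index of a bordered matrix by `ind_bordered`; the invertible factors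
`K`, `K'` drop out by congruence, leaving the block matrix of
`ind_add_ind_neg_eq_of_generalizedInverse`. -/
theorem compIndex_add_ind (hY : wronskian Y Y = 0) (hY' : wronskian Y' Y' = 0)
    (h : IsUnit (denom l Y).det) (h' : IsUnit (denom l Y').det) :
    compIndex Y Y' + ind (-coord l Y)
      = ind (coord l Y' - coord l Y) + ind (-coord l Y') := by
  obtain ⟨H, hH, h1, h2, hM, hP⟩ := exists_generalizedInverse hY hY' h h'
  have hA := isSymm_coord hY h
  have hB := isSymm_coord hY' h'
  have hF : (coord l Y' * H * coord l Y' - coord l Y').IsSymm := by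
    rw [IsSymm, transpose_sub, transpose_mul, transpose_mul, hB, hH, Matrix.mul_assoc]
  rw [← ind_add_ind_neg_eq_of_generalizedInverse hA hB hH h1 h2, compIndex, hP, matV,
    ← ind_bordered _ (isSymm_congruence hF _), hM, ind_bordered_congruence hF h h']
  simp only [transpose_sub, transpose_mul, hA.eq, hB.eq, hH.eq, Matrix.mul_assoc]

theorem dualCompIndex_add_ind (hY : wronskian Y Y = 0) (hY' : wronskian Y' Y' = 0)
    (h : IsUnit (denom l Y).det) (h' : IsUnit (denom l Y').det) :
    dualCompIndex Y Y' + ind (coord l Y)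
      = ind (coord l Y - coord l Y') + ind (coord l Y') := by
  obtain ⟨H, hH, h1, h2, hM, hP⟩ := exists_generalizedInverse hY hY' h h'
  have hA := isSymm_coord hY h
  have hB := isSymm_coord hY' h'
  have hF : (coord l Y' - coord l Y' * H * coord l Y').IsSymm := by
    rw [IsSymm, transpose_sub, transpose_mul, transpose_mul, hB, hH, Matrix.mul_assoc]
  have hneg : -matP Y Y' = matV Y Y' * ((denom l Y')ᵀ
      * (coord l Y' - coord l Y' * H * coord l Y') * denom l Y') * matV Y Y' := by
    rw [hP, ← Matrix.neg_mul, ← Matrix.mul_neg, ← Matrix.neg_mul, ← Matrix.mul_neg, neg_sub]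
  have hM' : matM Y Y' = (-denom l Y)ᵀ
      * (coord l Y * H * coord l Y' - coord l Y') * denom l Y' := by
    rw [hM, transpose_neg, Matrix.neg_mul, ← Matrix.mul_neg, neg_sub]
  -- Replacing `A, B, H` by their negatives also negates the border; `hM'` absorbs that sign into
  -- `-denom l Y`.
  have key := ind_add_ind_neg_eq_of_generalizedInverse hA.neg hB.neg hH.neg
    (by simpa using h1) (by simpa using h2)
  have hn : IsUnit (-denom l Y).det := by
    rw [det_neg]
    exact (IsUnit.pow _ isUnit_one.neg).mul h
  simp only [neg_neg, Matrix.neg_mul, Matrix.mul_neg, neg_sub_neg] at key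
  rw [← key, dualCompIndex, hneg, matV,
    ← ind_bordered _ (isSymm_congruence hF _), hM', ind_bordered_congruence hF hn h']
  simp only [transpose_sub, transpose_mul, hA.eq, hB.eq, hH.eq, Matrix.mul_assoc]

end ComparativeIndex

open Filter Topology

/-! ### Lagrangian frames and transversality -/

section Frames

variable {ι : Type*} [Fintype ι] [DecidableEq ι]

/-- The columns of `Y` form a basis of a Lagrangian plane. -/
structure IsFrame (Y : Matrix (ι ⊕ ι) ι ℝ) : Prop where
  wronskian_self : wronskian Y Y = 0
  eq_zero : ∀ c, Y *ᵥ c = 0 → c = 0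

theorem rank_eq_card_iff {m : Type*} [Fintype m] {Y : Matrix m ι ℝ} :
    Y.rank = Fintype.card ι ↔ ∀ c, Y *ᵥ c = 0 → c = 0 := by
  have hk := Y.mulVecLin.finrank_range_add_finrank_ker
  rw [Module.finrank_fintype_fun_eq_card] at hk
  have hr : Y.rank = Module.finrank ℝ (LinearMap.range Y.mulVecLin) := rfl
  rw [← hr] at hk
  constructor
  · intro h c hc
    have h0 : Module.finrank ℝ (LinearMap.ker Y.mulVecLin) = 0 := by omega
    rw [Submodule.finrank_eq_zero] at h0
    have : c ∈ LinearMap.ker Y.mulVecLin := hc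
    rwa [h0] at this
  · intro h
    have h0 : LinearMap.ker Y.mulVecLin = ⊥ := LinearMap.ker_eq_bot'.mpr h
    rw [h0, finrank_bot] at hk
    omega

theorem IsLagrangianPath.isFrame {a b : ℝ} {Y : ℝ → Matrix (ι ⊕ ι) ι ℝ}
    (h : IsLagrangianPath a b Y) {t : ℝ} (ht : t ∈ Icc a b) : IsFrame (Y t) :=
  ⟨h.isotropic t ht, rank_eq_card_iff.mp (h.rank_eq t ht)⟩

theorem isFrame_symplectic_mul_vert {S : Matrix (ι ⊕ ι) (ι ⊕ ι) ℝ} (hS : IsSymplectic S) :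
    IsFrame (S * vert ι) := by
  constructor
  · calc (S * vert ι)ᵀ * skewJ ι * (S * vert ι)
        = (vert ι)ᵀ * (Sᵀ * skewJ ι * S) * vert ι := by
          simp only [transpose_mul, Matrix.mul_assoc]
      _ = 0 := by
          rw [hS, vert, skewJ, transpose_fromRows, fromCols_mul_fromBlocks, fromCols_mul_fromRows]
          simp
  · intro c hc
    -- `EᵀJᵀSᵀJ` is a left inverse of `SE`, since `SᵀJS = J` and `EᵀJᵀJE = I`.
    have h1 : ((vert ι)ᵀ * (skewJ ι)ᵀ * (Sᵀ * skewJ ι * S) * vert ι) *ᵥ c = 0 := by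
      have : (vert ι)ᵀ * (skewJ ι)ᵀ * (Sᵀ * skewJ ι * S) * vert ι
          = ((vert ι)ᵀ * (skewJ ι)ᵀ * Sᵀ * skewJ ι) * (S * vert ι) := by
        simp only [Matrix.mul_assoc]
      rw [this, ← mulVec_mulVec, hc, mulVec_zero]
    have h2 : (vert ι)ᵀ * (skewJ ι)ᵀ * (Sᵀ * skewJ ι * S) * vert ι = 1 := by
      rw [hS, vert, skewJ, transpose_fromRows, fromBlocks_transpose, fromCols_mul_fromBlocks,
        fromCols_mul_fromBlocks, fromCols_mul_fromRows]
      simp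
    rwa [h2, one_mulVec] at h1

/-- A Lagrangian plane is transversal to all but finitely many of the planes `(I λI)ᵀ`. -/
theorem IsFrame.finite_not_isUnit_denom {Y : Matrix (ι ⊕ ι) ι ℝ} (hY : IsFrame Y) :
    {l : ℝ | ¬ IsUnit (denom l Y).det}.Finite := by
  have hex : ∀ l : {l : ℝ | ¬ IsUnit (denom l Y).det},
      ∃ c, c ≠ 0 ∧ denom l.1 Y *ᵥ c = 0 := fun l => by
    have h := l.2
    rw [mem_ofPred_eq, isUnit_iff_ne_zero, not_not] at h
    exact exists_mulVec_eq_zero_iff.mpr h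
  choose c hc0 hc using hex
  have hU : ∀ l, Y.toRows₂ *ᵥ c l = l.1 • Y.toRows₁ *ᵥ c l := fun l => by
    have := hc l
    rw [denom, sub_mulVec, sub_eq_zero, smul_mulVec] at this
    exact this.symm
  have hX0 : ∀ l, Y.toRows₁ *ᵥ c l ≠ 0 := fun l h => by
    refine hc0 l (hY.eq_zero _ ?_)
    rw [← fromRows_toRows Y, fromRows_mulVec, hU, h]
    ext i
    rcases i with i | i <;> simp
  have hsymm := hY.wronskian_self
  rw [wronskian_eq, sub_eq_zero] at hsymm
  -- As for eigenvectors of a symmetric matrix: `XᵀU` is symmetric and `U c_l = l X c_l`, so the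
  -- nonzero vectors `X c_l` are orthogonal for distinct `l`, and there are finitely many.
  have horth : ∀ l m, l ≠ m → (Y.toRows₁ *ᵥ c l) ⬝ᵥ (Y.toRows₁ *ᵥ c m) = 0 := fun l m hlm => by
    have h1 : (Y.toRows₁ *ᵥ c l) ⬝ᵥ (Y.toRows₂ *ᵥ c m)
        = (Y.toRows₂ *ᵥ c l) ⬝ᵥ (Y.toRows₁ *ᵥ c m) := by
      rw [← vecMul_transpose Y.toRows₁ (c l), ← vecMul_transpose Y.toRows₂ (c l),
        ← dotProduct_mulVec, ← dotProduct_mulVec, mulVec_mulVec, mulVec_mulVec, hsymm]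
    rw [hU, hU, dotProduct_smul, smul_dotProduct, smul_eq_mul, smul_eq_mul] at h1
    have h2 : (l.1 - m.1) * ((Y.toRows₁ *ᵥ c l) ⬝ᵥ (Y.toRows₁ *ᵥ c m)) = 0 := by linarith
    exact (mul_eq_zero.mp h2).resolve_left (sub_ne_zero.mpr fun h => hlm (Subtype.ext h))
  have hli : LinearIndependent ℝ fun l => WithLp.toLp 2 (Y.toRows₁ *ᵥ c l) := by
    refine linearIndependent_of_ne_zero_of_inner_eq_zero (fun l h => hX0 l ?_) ?_
    · simpa using h
    · intro l m hlm
      rw [EuclideanSpace.inner_toLp_toLp]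
      simpa using horth m l hlm.symm
  exact Set.finite_coe_iff.mp hli.finite_of_isNoetherian

end Frames

/-! ### The comparative index as a local primitive -/

section Local

variable {ι : Type*} [Fintype ι] [DecidableEq ι]

theorem continuous_toRows₁ : Continuous fun Y : Matrix (ι ⊕ ι) ι ℝ => Y.toRows₁ :=
  continuous_id.matrix_submatrix _ _

theorem continuous_denom (l : ℝ) : Continuous fun Y : Matrix (ι ⊕ ι) ι ℝ => denom l Y :=
  (continuous_toRows₁.const_smul l).sub (continuous_id.matrix_submatrix _ _)

theorem continuousAt_coord {l : ℝ} {Y : Matrix (ι ⊕ ι) ι ℝ} (h : IsUnit (denom l Y).det) :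
    ContinuousAt (coord l) Y := by
  have h1 : ContinuousAt (fun Y => (denom l Y)⁻¹) Y := by
    simp only [inv_def, Ring.inverse_eq_inv']
    exact ((continuous_denom l).matrix_det.continuousAt.inv₀ h.ne_zero).smul
      (continuous_denom l).matrix_adjugate.continuousAt
  have h2 : Continuous fun p : Matrix ι ι ℝ × Matrix ι ι ℝ => p.1 * p.2 :=
    continuous_fst.matrix_mul continuous_snd
  exact h2.continuousAt.comp (continuous_toRows₁.continuousAt.prodMk h1)

theorem eventually_isUnit_denom {l : ℝ} {Y : Matrix (ι ⊕ ι) ι ℝ} (h : IsUnit (denom l Y).det) :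
    ∀ᶠ Z in 𝓝 Y, IsUnit (denom l Z).det := by
  simp only [isUnit_iff_ne_zero] at h ⊢
  exact (continuous_denom l).matrix_det.continuousAt.eventually_ne h

/-- `G + a l` is locally constant on `[c, d]` near each point, for all but finitely many `l`. -/
def IsPrimitive (a : ℝ → ℝ → ℤ) (c d : ℝ) (G : ℝ → ℤ) : Prop :=
  ∀ τ ∈ Icc c d, ∃ Λ : Set ℝ, Λ.Finite ∧ ∀ l ∉ Λ,
    ∀ᶠ s in 𝓝[Icc c d] τ, G s + a l s = G τ + a l τ

/-- The index of the plane of `Y` relative to the vertical plane and `(I λI)ᵀ`. -/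
noncomputable def relIndex (l : ℝ) (Y : Matrix (ι ⊕ ι) ι ℝ) : ℤ :=
  ind (-((denom l Y)ᵀ * Y.toRows₁))

/-- The dual relative index, with the opposite sign of the form. -/
noncomputable def dualRelIndex (l : ℝ) (Y : Matrix (ι ⊕ ι) ι ℝ) : ℤ :=
  -ind ((denom l Y)ᵀ * Y.toRows₁)

/-- By Sylvester's law the index of the coordinate is that of a form without an inverse, which
passes to direct sums for every `l`. -/
theorem ind_neg_coord {l : ℝ} {Y : Matrix (ι ⊕ ι) ι ℝ} (hY : IsFrame Y)
    (h : IsUnit (denom l Y).det) : (ind (-coord l Y) : ℤ) = relIndex l Y := by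
  rw [relIndex, ← denom_congruence_coord h,
    ind_neg_congruence (isSymm_coord hY.wronskian_self h) (mul_nonsing_inv _ h)]

theorem ind_coord {l : ℝ} {Y : Matrix (ι ⊕ ι) ι ℝ} (hY : IsFrame Y)
    (h : IsUnit (denom l Y).det) : (ind (coord l Y) : ℤ) = -dualRelIndex l Y := by
  rw [dualRelIndex, ← denom_congruence_coord h,
    ind_congruence (isSymm_coord hY.wronskian_self h) (mul_nonsing_inv _ h), neg_neg]

/-- Near `τ`, for `l` transversal to both planes, the ranks of `B` and `A - B` are `r'` and `r`.
Hence all index terms in the coordinate formula other than those of `Y` alone are locally constant.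
-/
theorem isPrimitive_compIndex {c d : ℝ} {Y Z : ℝ → Matrix (ι ⊕ ι) ι ℝ}
    (hYc : ContinuousOn Y (Icc c d)) (hZc : ContinuousOn Z (Icc c d))
    (hY : ∀ s ∈ Icc c d, IsFrame (Y s)) (hZ : ∀ s ∈ Icc c d, IsFrame (Z s)) {r r' : ℕ}
    (hr : ∀ s ∈ Icc c d, (wronskian (Z s) (Y s)).rank = r)
    (hr' : ∀ s ∈ Icc c d, ((Z s).toRows₁).rank = r') :
    IsPrimitive (fun l s => relIndex l (Y s)) c d (fun s => compIndex (Y s) (Z s)) ∧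
    IsPrimitive (fun l s => dualRelIndex l (Y s)) c d (fun s => -dualCompIndex (Y s) (Z s)) := by
  have main : ∀ τ ∈ Icc c d, ∃ Λ : Set ℝ, Λ.Finite ∧ ∀ l ∉ Λ, ∀ᶠ s in 𝓝[Icc c d] τ,
      (compIndex (Y s) (Z s) + relIndex l (Y s) = compIndex (Y τ) (Z τ) + relIndex l (Y τ)) ∧
      (-dualCompIndex (Y s) (Z s) + dualRelIndex l (Y s)
        = -dualCompIndex (Y τ) (Z τ) + dualRelIndex l (Y τ)) := by
    intro τ hτ
    refine ⟨_, (hY τ hτ).finite_not_isUnit_denom.union (hZ τ hτ).finite_not_isUnit_denom,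
      fun l hl => ?_⟩
    rw [mem_union, not_or, mem_ofPred_eq, mem_ofPred_eq, not_not, not_not] at hl
    obtain ⟨h1, h2⟩ := hl
    have e1 := (hYc τ hτ).eventually (eventually_isUnit_denom h1)
    have e2 := (hZc τ hτ).eventually (eventually_isUnit_denom h2)
    have cA : ContinuousWithinAt (fun s => coord l (Y s)) (Icc c d) τ :=
      (continuousAt_coord h1).comp_continuousWithinAt (hYc τ hτ)
    have cB : ContinuousWithinAt (fun s => coord l (Z s)) (Icc c d) τ :=
      (continuousAt_coord h2).comp_continuousWithinAt (hZc τ hτ)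
    have sA : ∀ᶠ s in 𝓝[Icc c d] τ, (coord l (Y s)).IsSymm := by
      filter_upwards [e1, self_mem_nhdsWithin] with s h hs
      exact isSymm_coord (hY s hs).wronskian_self h
    have sB : ∀ᶠ s in 𝓝[Icc c d] τ, (coord l (Z s)).IsSymm := by
      filter_upwards [e2, self_mem_nhdsWithin] with s h hs
      exact isSymm_coord (hZ s hs).wronskian_self h
    have rB : ∀ᶠ s in 𝓝[Icc c d] τ, (coord l (Z s)).rank = r' := by
      filter_upwards [e2, self_mem_nhdsWithin] with s h hs
      rw [← hr' s hs, ← coord_mul_denom h, rank_mul_eq_left_of_isUnit_det _ _ h]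
    have rAB : ∀ᶠ s in 𝓝[Icc c d] τ, (coord l (Y s) - coord l (Z s)).rank = r := by
      filter_upwards [e1, e2, self_mem_nhdsWithin] with s h h' hs
      rw [← hr s hs, wronskian_eq_denom_mul (hZ s hs).wronskian_self h' h,
        rank_mul_eq_left_of_isUnit_det _ _ h,
        rank_mul_eq_right_of_isUnit_det _ _ (by simpa using h')]
    have iB := eventually_ind_eq cB sB hτ (rB.mono fun s h => by
      rw [h, rB.self_of_nhdsWithin hτ])
    have iAB := eventually_ind_eq (cA.sub cB)
      (sA.and sB |>.mono fun s h => h.1.sub h.2) hτ (rAB.mono fun s h => by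
        exact h.trans (rAB.self_of_nhdsWithin hτ).symm)
    filter_upwards [e1, e2, iB, iAB, self_mem_nhdsWithin] with s k1 k2 k3 k4 hs
    have m1 := compIndex_add_ind (hY s hs).wronskian_self (hZ s hs).wronskian_self k1 k2
    have m2 := compIndex_add_ind (hY τ hτ).wronskian_self (hZ τ hτ).wronskian_self h1 h2
    have m3 := dualCompIndex_add_ind (hY s hs).wronskian_self (hZ s hs).wronskian_self k1 k2
    have m4 := dualCompIndex_add_ind (hY τ hτ).wronskian_self (hZ τ hτ).wronskian_self h1 h2
    have n1 := ind_neg_coord (hY s hs) k1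
    have n2 := ind_neg_coord (hY τ hτ) h1
    have n3 := ind_coord (hY s hs) k1
    have n4 := ind_coord (hY τ hτ) h1
    simp only [Pi.sub_apply, neg_sub] at k4
    omega
  refine ⟨fun τ hτ => ?_, fun τ hτ => ?_⟩ <;> obtain ⟨Λ, h1, h2⟩ := main τ hτ
  · exact ⟨Λ, h1, fun l hl => (h2 l hl).mono fun s h => h.1⟩
  · exact ⟨Λ, h1, fun l hl => (h2 l hl).mono fun s h => h.2⟩

end Local

/-! ### Gluing and uniqueness of primitives -/

section Primitives

variable {a : ℝ → ℝ → ℤ} {c d e : ℝ} {G G' : ℝ → ℤ}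

theorem IsPrimitive.glue (hcd : c ≤ d) (hde : d ≤ e) (h : IsPrimitive a c d G)
    (h' : IsPrimitive a d e G') :
    IsPrimitive a c e (fun s => if s ≤ d then G s else G' s - G' d + G d) := by
  intro τ hτ
  set F : ℝ → ℤ := fun s => if s ≤ d then G s else G' s - G' d + G d with hF
  have hF1 : ∀ s ∈ Icc c d, F s = G s := fun s hs => if_pos hs.2
  have hF2 : ∀ s ∈ Icc d e, F s = G' s - G' d + G d := fun s hs => by
    rcases hs.1.eq_or_lt with rfl | h
    · simp [hF]
    · exact if_neg (not_le.mpr h)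
  have g1 : ∃ Λ : Set ℝ, Λ.Finite ∧ ∀ l ∉ Λ, ∀ᶠ s in 𝓝[Icc c d] τ, F s + a l s = F τ + a l τ := by
    by_cases hm : τ ∈ Icc c d
    · obtain ⟨Λ, h1, h2⟩ := h τ hm
      refine ⟨Λ, h1, fun l hl => ?_⟩
      filter_upwards [h2 l hl, self_mem_nhdsWithin] with s k1 k2
      rw [hF1 s k2, hF1 τ hm, k1]
    · refine ⟨∅, finite_empty, fun l _ => ?_⟩
      -- Away from the closed subinterval there is nothing to check on its side.
      have : 𝓝[Icc c d] τ = ⊥ := by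
        rw [← notMem_closure_iff_nhdsWithin_eq_bot, isClosed_Icc.closure_eq]; exact hm
      rw [this]; exact eventually_bot
  have g2 : ∃ Λ : Set ℝ, Λ.Finite ∧ ∀ l ∉ Λ, ∀ᶠ s in 𝓝[Icc d e] τ, F s + a l s = F τ + a l τ := by
    by_cases hm : τ ∈ Icc d e
    · obtain ⟨Λ, h1, h2⟩ := h' τ hm
      refine ⟨Λ, h1, fun l hl => ?_⟩
      filter_upwards [h2 l hl, self_mem_nhdsWithin] with s k1 k2
      rw [hF2 s k2, hF2 τ hm]
      linarith
    · refine ⟨∅, finite_empty, fun l _ => ?_⟩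
      have : 𝓝[Icc d e] τ = ⊥ := by
        rw [← notMem_closure_iff_nhdsWithin_eq_bot, isClosed_Icc.closure_eq]; exact hm
      rw [this]; exact eventually_bot
  obtain ⟨Λ1, f1, k1⟩ := g1
  obtain ⟨Λ2, f2, k2⟩ := g2
  refine ⟨Λ1 ∪ Λ2, f1.union f2, fun l hl => ?_⟩
  rw [mem_union, not_or] at hl
  rw [← Icc_union_Icc_eq_Icc hcd hde, nhdsWithin_union, eventually_sup]
  exact ⟨k1 l hl.1, k2 l hl.2⟩

/-- At each point a common `l` avoids both finite exceptional sets, and subtracting cancels `a`. So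
`G - G'` is a continuous integer-valued function on a connected set. -/
theorem IsPrimitive.sub_eq_sub (hcd : c ≤ d) (h : IsPrimitive a c d G)
    (h' : IsPrimitive a c d G') : G d - G c = G' d - G' c := by
  have hcont : ContinuousOn (fun s => G s - G' s) (Icc c d) := by
    intro τ hτ
    obtain ⟨Λ, f, k⟩ := h τ hτ
    obtain ⟨Λ', f', k'⟩ := h' τ hτ
    obtain ⟨l, hl⟩ := (f.union f').infinite_compl.nonempty
    rw [mem_compl_iff, mem_union, not_or] at hl
    rw [ContinuousWithinAt, nhds_discrete, tendsto_pure]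
    filter_upwards [k l hl.1, k' l hl.2] with s k1 k2
    linarith
  have := isPreconnected_Icc.constant hcont (left_mem_Icc.mpr hcd) (right_mem_Icc.mpr hcd)
  linarith

/-- Gluing shifts each piece to agree with its predecessor, so jumps between `m k` and `m (k + 1)`
at a partition point do not count and the increments telescope. -/
theorem exists_isPrimitive_of_partition {p : ℕ} {t : Fin (p + 1) → ℝ} (ht : Monotone t)
    {m : Fin p → ℝ → ℤ} (hm : ∀ k, IsPrimitive a (t k.castSucc) (t k.succ) (m k)) :
    ∃ G, IsPrimitive a (t 0) (t (Fin.last p)) G ∧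
      G (t (Fin.last p)) - G (t 0) = ∑ k, (m k (t k.succ) - m k (t k.castSucc)) := by
  induction p with
  | zero =>
    refine ⟨0, fun τ hτ => ⟨∅, finite_empty, fun l _ => ?_⟩, by simp⟩
    filter_upwards [self_mem_nhdsWithin] with s hs
    have h1 : Fin.last 0 = 0 := rfl
    rw [h1, Icc_self, mem_singleton_iff] at hs hτ
    rw [hs, hτ]
  | succ p ih =>
    obtain ⟨G, h1, h2⟩ := ih (t := fun k => t k.castSucc) (m := fun k => m k.castSucc)
      (fun i j hij => ht (Fin.castSucc_le_castSucc_iff.mpr hij)) (fun k => hm k.castSucc)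
    have h3 := hm (Fin.last p)
    have l1 : t 0 ≤ t (Fin.last p).castSucc := ht (Fin.zero_le _)
    have l2 : t (Fin.last p).castSucc ≤ t (Fin.last p).succ := ht (Fin.castSucc_le_succ _)
    refine ⟨_, IsPrimitive.glue l1 l2 h1 h3, ?_⟩
    rw [Fin.sum_univ_castSucc, Fin.succ_last] at *
    simp only [Fin.castSucc_zero, Fin.succ_castSucc] at *
    rw [← h2, if_pos l1]
    -- The first case is a degenerate last piece, since `t` is only assumed monotone.
    split_ifs with h4
    · rw [le_antisymm h4 l2]; ring
    · ring

end Primitives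

/-! ### Existence and independence of oscillation numbers -/

section Oscillation

variable {ι : Type*} [Fintype ι] [DecidableEq ι] {a b : ℝ} {Y : ℝ → Matrix (ι ⊕ ι) ι ℝ}

theorem IsAdmissible.exists_isPrimitive {p : ℕ} {t : Fin (p + 1) → ℝ}
    {R : Fin p → ℝ → Matrix (ι ⊕ ι) (ι ⊕ ι) ℝ} (h : IsAdmissible a b Y t R)
    (hY : IsLagrangianPath a b Y) :
    (∃ G, IsPrimitive (fun l s => relIndex l (Y s)) a b G ∧ G b - G a = oscSum Y t R) ∧
    (∃ G, IsPrimitive (fun l s => dualRelIndex l (Y s)) a b G ∧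
      G b - G a = dualOscSum Y t R) := by
  have hsub : ∀ k : Fin p, Icc (t k.castSucc) (t k.succ) ⊆ Icc a b := fun k =>
    Icc_subset_Icc (h.left_eq ▸ h.strictMono.monotone (Fin.zero_le _))
      (h.right_eq ▸ h.strictMono.monotone (Fin.le_last _))
  have hm : ∀ k : Fin p,
      IsPrimitive (fun l s => relIndex l (Y s)) (t k.castSucc) (t k.succ)
        (fun s => compIndex (Y s) (R k s * vert ι)) ∧
      IsPrimitive (fun l s => dualRelIndex l (Y s)) (t k.castSucc) (t k.succ)
        (fun s => -dualCompIndex (Y s) (R k s * vert ι)) := fun k => by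
    obtain ⟨r, hr⟩ := h.rank_wronskian k
    obtain ⟨r', hr'⟩ := h.rank_upper k
    have hcont : Continuous fun S : Matrix (ι ⊕ ι) (ι ⊕ ι) ℝ => S * vert ι :=
      continuous_id.matrix_mul continuous_const
    exact isPrimitive_compIndex (hY.continuousOn.mono (hsub k))
      (hcont.comp_continuousOn (h.continuousOn k)) (fun s hs => hY.isFrame (hsub k hs))
      (fun s hs => isFrame_symplectic_mul_vert (h.symplectic k s (hsub k hs))) hr hr'
  obtain ⟨G, g1, g2⟩ := exists_isPrimitive_of_partition h.strictMono.monotone fun k => (hm k).1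
  obtain ⟨G', g3, g4⟩ := exists_isPrimitive_of_partition h.strictMono.monotone fun k => (hm k).2
  rw [h.left_eq, h.right_eq] at g1 g2 g3 g4
  refine ⟨⟨G, g1, g2⟩, G', g3, g4.trans (Finset.sum_congr rfl fun k _ => ?_)⟩
  ring

/-- A constant symplectic matrix that maps the vertical plane to the span of `(I λI)ᵀ`. -/
def shearedRotation (ι : Type*) [DecidableEq ι] (l : ℝ) : Matrix (ι ⊕ ι) (ι ⊕ ι) ℝ :=
  fromBlocks 0 1 (-1) (l • 1)

theorem isSymplectic_shearedRotation (l : ℝ) : IsSymplectic (shearedRotation ι l) := by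
  simp [IsSymplectic, shearedRotation, skewJ, fromBlocks_transpose, fromBlocks_multiply]

theorem shearedRotation_mul_vert (l : ℝ) :
    shearedRotation ι l * vert ι = fromRows 1 (l • 1) := by
  rw [shearedRotation, vert, fromBlocks_mul_fromRows]
  simp

theorem exists_uniform_partition (hab : a < b) {δ : ℝ} (hδ : 0 < δ) :
    ∃ (p : ℕ) (t : Fin (p + 1) → ℝ), StrictMono t ∧ t 0 = a ∧ t (Fin.last p) = b ∧
      ∀ k : Fin p, t k.succ - t k.castSucc < δ := by
  obtain ⟨p, hp⟩ := exists_nat_gt ((b - a) / δ)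
  have hp0 : (0 : ℝ) < p := (div_nonneg (sub_pos.mpr hab).le hδ.le).trans_lt hp
  have hstep : 0 < (b - a) / p := div_pos (sub_pos.mpr hab) hp0
  refine ⟨p, fun k => a + k * ((b - a) / p), fun i j hij => ?_, by simp, ?_, fun k => ?_⟩
  · have : ((i : ℕ) : ℝ) < (j : ℕ) := by exact_mod_cast hij
    have := mul_lt_mul_of_pos_right this hstep
    simpa using this
  · simp only [Fin.val_last]
    field_simp
    ring
  · simp only [Fin.val_succ, Fin.val_castSucc, Nat.cast_add, Nat.cast_one]
    have : (b - a) / p < δ := by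
      rw [div_lt_iff₀ hδ] at hp
      rw [div_lt_iff₀ hp0]
      linarith
    linarith

/-- Each `Y s` is transversal to some plane `(I λI)ᵀ`, and transversality is open. A Lebesgue number
yields a partition with one `λ` per piece, where a constant `R_k` works: its upper block is `I` and
the Wronskian is `-(λX - U)`, of full rank. -/
theorem IsLagrangianPath.exists_isAdmissible (hab : a < b) (hY : IsLagrangianPath a b Y) :
    ∃ (p : ℕ) (t : Fin (p + 1) → ℝ) (R : Fin p → ℝ → Matrix (ι ⊕ ι) (ι ⊕ ι) ℝ),
      IsAdmissible a b Y t R := by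
  -- The determinant is extended continuously to the whole line so that the covering sets are open
  -- in `ℝ`.
  have hcont : ∀ l, Continuous (IccExtend hab.le ((Icc a b).domRestrict fun s => (denom l (Y s)).det)) :=
    fun l => (continuousOn_iff_continuous_domRestrict.mp
      ((continuous_denom l).matrix_det.comp_continuousOn hY.continuousOn)).Icc_extend'
  have hval : ∀ l, ∀ s ∈ Icc a b,
      IccExtend hab.le ((Icc a b).domRestrict fun s => (denom l (Y s)).det) s
        = (denom l (Y s)).det := fun l s hs => IccExtend_of_mem _ _ hs
  obtain ⟨δ, hδ, hball⟩ := lebesgue_number_lemma_of_metric (isCompact_Icc (a := a) (b := b))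
    (c := fun l : ℝ =>
      {s | IccExtend hab.le ((Icc a b).domRestrict fun s => (denom l (Y s)).det) s ≠ 0})
    (fun l => isOpen_ne_fun (hcont l) continuous_const) (fun s hs => by
      obtain ⟨l, hl⟩ := (hY.isFrame hs).finite_not_isUnit_denom.infinite_compl.nonempty
      rw [mem_compl_iff, mem_ofPred_eq, not_not] at hl
      refine mem_iUnion.mpr ⟨l, ?_⟩
      rw [mem_ofPred_eq, hval l s hs]
      exact hl.ne_zero)
  obtain ⟨p, t, ht, h0, hp, hstep⟩ := exists_uniform_partition hab hδ
  have hsub : ∀ k : Fin p, Icc (t k.castSucc) (t k.succ) ⊆ Icc a b := fun k =>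
    Icc_subset_Icc (h0 ▸ ht.monotone (Fin.zero_le _)) (hp ▸ ht.monotone (Fin.le_last _))
  have hex : ∀ k : Fin p, ∃ l, ∀ s ∈ Icc (t k.castSucc) (t k.succ),
      IsUnit (denom l (Y s)).det := fun k => by
    obtain ⟨l, hl⟩ := hball (t k.castSucc)
      (hsub k (left_mem_Icc.mpr (ht.monotone (Fin.castSucc_le_succ k))))
    refine ⟨l, fun s hs => ?_⟩
    have h1 : s ∈ Metric.ball (t k.castSucc) δ := by
      rw [Metric.mem_ball, Real.dist_eq, abs_of_nonneg (sub_nonneg.mpr hs.1)]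
      linarith [hs.2, hstep k]
    have h2 := hl h1
    rw [mem_ofPred_eq, hval l s (hsub k hs)] at h2
    exact isUnit_iff_ne_zero.mpr h2
  choose l hl using hex
  refine ⟨p, t, fun k _ => shearedRotation ι (l k), ht, h0, hp,
    fun k s _ => isSymplectic_shearedRotation _, fun k => continuousOn_const,
    fun k => ⟨Fintype.card ι, fun s hs => ?_⟩, fun k => ⟨_, fun s _ => rfl⟩⟩
  have h1 : wronskian (shearedRotation ι (l k) * vert ι) (Y s)
      = (-1 : Matrix ι ι ℝ) * denom (l k) (Y s) := by
    rw [shearedRotation_mul_vert, wronskian_eq, toRows₁_fromRows, toRows₂_fromRows, denom]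
    simp
  rw [h1, rank_mul_eq_left_of_isUnit_det _ _ (hl k s hs)]
  exact rank_of_isUnit _ isUnit_one.neg

/-- One primitive accounts for all admissible pairs: its increment over `[a, b]` is the only
possible value, and it is attained. -/
theorem IsLagrangianPath.exists_isPrimitive (hab : a < b) (hY : IsLagrangianPath a b Y) :
    (∃ G, IsPrimitive (fun l s => relIndex l (Y s)) a b G ∧
      ∀ ν, IsOscValue a b Y ν ↔ ν = G b - G a) ∧
    (∃ G, IsPrimitive (fun l s => dualRelIndex l (Y s)) a b G ∧
      ∀ ν, IsDualOscValue a b Y ν ↔ ν = G b - G a) := by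
  obtain ⟨p, t, R, h⟩ := hY.exists_isAdmissible hab
  obtain ⟨⟨G, g1, g2⟩, G', g3, g4⟩ := h.exists_isPrimitive hY
  refine ⟨⟨G, g1, fun ν => ⟨?_, ?_⟩⟩, G', g3, fun ν => ⟨?_, ?_⟩⟩
  · rintro ⟨q, u, S, hS, rfl⟩
    obtain ⟨⟨F, f1, f2⟩, -⟩ := hS.exists_isPrimitive hY
    rw [← f2]
    exact f1.sub_eq_sub hab.le g1
  · rintro rfl
    exact ⟨p, t, R, h, g2.symm⟩
  · rintro ⟨q, u, S, hS, rfl⟩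
    obtain ⟨-, F, f1, f2⟩ := hS.exists_isPrimitive hY
    rw [← f2]
    exact f1.sub_eq_sub hab.le g3
  · rintro rfl
    exact ⟨p, t, R, h, g4.symm⟩

theorem oscNumber_eq {ν : ℤ} (h : ∀ ν', IsOscValue a b Y ν' ↔ ν' = ν) : oscNumber a b Y = ν :=
  (h _).mp (Classical.epsilon_spec ⟨ν, (h ν).mpr rfl⟩)

theorem dualOscNumber_eq {ν : ℤ} (h : ∀ ν', IsDualOscValue a b Y ν' ↔ ν' = ν) :
    dualOscNumber a b Y = ν :=
  (h _).mp (Classical.epsilon_spec ⟨ν, (h ν).mpr rfl⟩)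

end Oscillation

/-! ### Direct sums of Lagrangian paths -/

section DirectSum

variable {ι₁ ι₂ : Type*} [Fintype ι₁] [DecidableEq ι₁] [Fintype ι₂] [DecidableEq ι₂]

theorem fromBlocks_diagonal_sub {l m n o : Type*} (A A' : Matrix l m ℝ) (D D' : Matrix n o ℝ) :
    fromBlocks A 0 0 D - fromBlocks A' 0 0 D' = fromBlocks (A - A') 0 0 (D - D') := by
  ext i j
  rcases i with i | i <;> rcases j with j | j <;> simp

theorem permPi_mul_fromBlocks (Y₁ : Matrix (ι₁ ⊕ ι₁) ι₁ ℝ) (Y₂ : Matrix (ι₂ ⊕ ι₂) ι₂ ℝ) :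
    permPi ι₁ ι₂ * fromBlocks Y₁ 0 0 Y₂ = fromRows
      (fromBlocks Y₁.toRows₁ 0 0 Y₂.toRows₁) (fromBlocks Y₁.toRows₂ 0 0 Y₂.toRows₂) := by
  ext i j
  rcases i with (i | i) | (i | i) <;> rcases j with j | j <;>
    simp [permPi, Matrix.mul_apply, Fintype.sum_sum_type, one_apply]

theorem wronskian_directSum (Y₁ : Matrix (ι₁ ⊕ ι₁) ι₁ ℝ) (Y₂ : Matrix (ι₂ ⊕ ι₂) ι₂ ℝ) :
    wronskian (permPi ι₁ ι₂ * fromBlocks Y₁ 0 0 Y₂) (permPi ι₁ ι₂ * fromBlocks Y₁ 0 0 Y₂)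
      = fromBlocks (wronskian Y₁ Y₁) 0 0 (wronskian Y₂ Y₂) := by
  rw [permPi_mul_fromBlocks, wronskian_eq, wronskian_eq, wronskian_eq]
  simp [fromBlocks_transpose, fromBlocks_multiply, fromBlocks_diagonal_sub]

theorem denom_directSum (l : ℝ) (Y₁ : Matrix (ι₁ ⊕ ι₁) ι₁ ℝ) (Y₂ : Matrix (ι₂ ⊕ ι₂) ι₂ ℝ) :
    (denom l (permPi ι₁ ι₂ * fromBlocks Y₁ 0 0 Y₂))ᵀ
        * (permPi ι₁ ι₂ * fromBlocks Y₁ 0 0 Y₂).toRows₁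
      = fromBlocks ((denom l Y₁)ᵀ * Y₁.toRows₁) 0 0 ((denom l Y₂)ᵀ * Y₂.toRows₁) := by
  rw [permPi_mul_fromBlocks, denom, denom, denom]
  simp [fromBlocks_transpose, fromBlocks_multiply, fromBlocks_diagonal_sub, fromBlocks_smul]

theorem relIndex_directSum (l : ℝ) (Y₁ : Matrix (ι₁ ⊕ ι₁) ι₁ ℝ) (Y₂ : Matrix (ι₂ ⊕ ι₂) ι₂ ℝ) :
    relIndex l (permPi ι₁ ι₂ * fromBlocks Y₁ 0 0 Y₂) = relIndex l Y₁ + relIndex l Y₂ := by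
  rw [relIndex, denom_directSum, fromBlocks_neg, neg_zero, neg_zero, ind_fromBlocks]
  simp [relIndex]

theorem dualRelIndex_directSum (l : ℝ) (Y₁ : Matrix (ι₁ ⊕ ι₁) ι₁ ℝ)
    (Y₂ : Matrix (ι₂ ⊕ ι₂) ι₂ ℝ) :
    dualRelIndex l (permPi ι₁ ι₂ * fromBlocks Y₁ 0 0 Y₂)
      = dualRelIndex l Y₁ + dualRelIndex l Y₂ := by
  rw [dualRelIndex, denom_directSum, ind_fromBlocks]
  simp only [dualRelIndex, Nat.cast_add]
  ring

theorem IsPrimitive.add {a a₁ a₂ : ℝ → ℝ → ℤ} {c d : ℝ} {G₁ G₂ : ℝ → ℤ}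
    (h₁ : IsPrimitive a₁ c d G₁) (h₂ : IsPrimitive a₂ c d G₂)
    (ha : ∀ l, ∀ s ∈ Icc c d, a l s = a₁ l s + a₂ l s) :
    IsPrimitive a c d (fun s => G₁ s + G₂ s) := by
  intro τ hτ
  obtain ⟨Λ₁, f₁, k₁⟩ := h₁ τ hτ
  obtain ⟨Λ₂, f₂, k₂⟩ := h₂ τ hτ
  refine ⟨Λ₁ ∪ Λ₂, f₁.union f₂, fun l hl => ?_⟩
  rw [mem_union, not_or] at hl
  filter_upwards [k₁ l hl.1, k₂ l hl.2, self_mem_nhdsWithin] with s e₁ e₂ hs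
  rw [ha l s hs, ha l τ hτ]
  linarith

theorem IsLagrangianPath.directSum {a b : ℝ} {Y₁ : ℝ → Matrix (ι₁ ⊕ ι₁) ι₁ ℝ}
    {Y₂ : ℝ → Matrix (ι₂ ⊕ ι₂) ι₂ ℝ} (h₁ : IsLagrangianPath a b Y₁)
    (h₂ : IsLagrangianPath a b Y₂) {Y : ℝ → Matrix ((ι₁ ⊕ ι₂) ⊕ (ι₁ ⊕ ι₂)) (ι₁ ⊕ ι₂) ℝ}
    (hY : ∀ t ∈ Icc a b, Y t = permPi ι₁ ι₂ * fromBlocks (Y₁ t) 0 0 (Y₂ t)) :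
    IsLagrangianPath a b Y := by
  refine ⟨?_, fun t ht => ?_, fun t ht => ?_⟩
  · have hc : Continuous fun p : Matrix (ι₁ ⊕ ι₁) ι₁ ℝ × Matrix (ι₂ ⊕ ι₂) ι₂ ℝ =>
        permPi ι₁ ι₂ * fromBlocks p.1 0 0 p.2 :=
      continuous_const.matrix_mul
        (continuous_fst.matrix_fromBlocks continuous_const continuous_const continuous_snd)
    exact (hc.comp_continuousOn (h₁.continuousOn.prodMk h₂.continuousOn)).congr hY
  · have h := wronskian_directSum (Y₁ t) (Y₂ t)
    rw [(h₁.isFrame ht).wronskian_self, (h₂.isFrame ht).wronskian_self, fromBlocks_zero,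
      ← hY t ht] at h
    exact h
  · rw [rank_eq_card_iff]
    intro c hc
    rw [hY t ht, permPi_mul_fromBlocks, fromRows_mulVec, fromBlocks_mulVec, fromBlocks_mulVec] at hc
    simp only [zero_mulVec, add_zero, zero_add] at hc
    have e₁ : c ∘ Sum.inl = 0 := (h₁.isFrame ht).eq_zero _ (by
      rw [← fromRows_toRows (Y₁ t), fromRows_mulVec]
      ext i
      rcases i with i | i
      · exact congrFun hc (Sum.inl (Sum.inl i))
      · exact congrFun hc (Sum.inr (Sum.inl i)))
    have e₂ : c ∘ Sum.inr = 0 := (h₂.isFrame ht).eq_zero _ (by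
      rw [← fromRows_toRows (Y₂ t), fromRows_mulVec]
      ext i
      rcases i with i | i
      · exact congrFun hc (Sum.inl (Sum.inr i))
      · exact congrFun hc (Sum.inr (Sum.inr i)))
    ext i
    rcases i with i | i
    · exact congrFun e₁ i
    · exact congrFun e₂ i

end DirectSum

end Lagr

/-- For continuous Lagrangian paths `Y₁`, `Y₂` on `[a, b]`, the path `Y = Π diag{Y₁, Y₂}` is a
continuous Lagrangian path with blocks `diag{X₁, X₂}` and `diag{U₁, U₂}`; the (dual) oscillation
numbers of the three paths exist and do not depend on the admissible data, and those of `Y` are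
the sums of those of `Y₁` and `Y₂`. -/
theorem theoremT {ι₁ ι₂ : Type*} [Fintype ι₁] [DecidableEq ι₁] [Fintype ι₂] [DecidableEq ι₂]
    (a b : ℝ) (hab : a < b)
    (Y₁ : ℝ → Matrix (ι₁ ⊕ ι₁) ι₁ ℝ) (Y₂ : ℝ → Matrix (ι₂ ⊕ ι₂) ι₂ ℝ)
    (h₁ : IsLagrangianPath a b Y₁) (h₂ : IsLagrangianPath a b Y₂)
    (Y : ℝ → Matrix ((ι₁ ⊕ ι₂) ⊕ (ι₁ ⊕ ι₂)) (ι₁ ⊕ ι₂) ℝ)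
    (hY : ∀ t ∈ Set.Icc a b, Y t = permPi ι₁ ι₂ * Matrix.fromBlocks (Y₁ t) 0 0 (Y₂ t)) :
    (∀ t ∈ Set.Icc a b, Y t = Matrix.fromRows
        (Matrix.fromBlocks (Y₁ t).toRows₁ 0 0 (Y₂ t).toRows₁)
        (Matrix.fromBlocks (Y₁ t).toRows₂ 0 0 (Y₂ t).toRows₂)) ∧
    IsLagrangianPath a b Y ∧
    ((∃! ν, IsOscValue a b Y₁ ν) ∧ (∃! ν, IsOscValue a b Y₂ ν) ∧ (∃! ν, IsOscValue a b Y ν)) ∧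
    ((∃! ν, IsDualOscValue a b Y₁ ν) ∧ (∃! ν, IsDualOscValue a b Y₂ ν) ∧
      (∃! ν, IsDualOscValue a b Y ν)) ∧
    oscNumber a b Y = oscNumber a b Y₁ + oscNumber a b Y₂ ∧
    dualOscNumber a b Y = dualOscNumber a b Y₁ + dualOscNumber a b Y₂ := by
  have h := h₁.directSum h₂ hY
  obtain ⟨⟨G₁, p₁, v₁⟩, D₁, q₁, w₁⟩ := h₁.exists_isPrimitive hab
  obtain ⟨⟨G₂, p₂, v₂⟩, D₂, q₂, w₂⟩ := h₂.exists_isPrimitive hab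
  obtain ⟨⟨G, p, v⟩, D, q, w⟩ := h.exists_isPrimitive hab
  refine ⟨fun t ht => by rw [hY t ht, permPi_mul_fromBlocks], h,
    ⟨⟨_, (v₁ _).mpr rfl, fun ν => (v₁ ν).mp⟩, ⟨_, (v₂ _).mpr rfl, fun ν => (v₂ ν).mp⟩,
      ⟨_, (v _).mpr rfl, fun ν => (v ν).mp⟩⟩,
    ⟨⟨_, (w₁ _).mpr rfl, fun ν => (w₁ ν).mp⟩, ⟨_, (w₂ _).mpr rfl, fun ν => (w₂ ν).mp⟩,
      ⟨_, (w _).mpr rfl, fun ν => (w ν).mp⟩⟩, ?_, ?_⟩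
  · rw [oscNumber_eq v, oscNumber_eq v₁, oscNumber_eq v₂,
      -- The sum of the primitives of `Y₁` and `Y₂` is compared with the primitive of `Y`; all three
      -- come from unrelated admissible pairs.
      p.sub_eq_sub hab.le (p₁.add p₂ fun l s hs => by rw [hY s hs, relIndex_directSum])]
    ring
  · rw [dualOscNumber_eq w, dualOscNumber_eq w₁, dualOscNumber_eq w₂,
      q.sub_eq_sub hab.le (q₁.add q₂ fun l s hs => by rw [hY s hs, dualRelIndex_directSum])]
    ring
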